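/- For a finite set $S$, equip $S^{\mathbb Z}$ with the distance $d(c,c)=0$ and $d(c,c')=2^{-\min\{|j|\,:\,c_j\neq c'_j\}}$ for $c\neq c'$. A map $F:S^{\mathbb Z}\to S^{\mathbb Z}$ is positively expansive if there is $\varepsilon>0$ such that for all $c\neq c'$ in $S^{\mathbb Z}$ there is $\ell\in\mathbb N$ with $d(F^\ell(c),F^\ell(c'))\geq\varepsilon$. The cellular automaton (CA) over $S$ of radius $r\in\mathbb N$ with local rule $f:S^{2r+1}\to S$ is the map $F:S^{\mathbb Z}\to S^{\mathbb Z}$, $F(c)_i=f(c_{i-r},\dots,c_{i+r})$. If $G$ is a finite abelian group, a CA $F$ over $G$ is additive if $F$ is an endomorphism of the group $G^{\mathbb Z}$. **(1)** Positive expansivity is decidable for additive CA over finite abelian groups: there is one algorithm which, given as input any finite abelian group $G$ (as an addition table), any $r\in\mathbb N$ and any local rule $f:G^{2r+1}\to G$ (as a table of values) whose CA $F$ is additive, decides whether $F$ is positively expansive. **(2)** Let $p$ be a prime, $n\geq1$, and $k_1\geq k_2\geq\dots\geq k_n\geq1$ integers. Let $G=\mathbb Z/p^{k_1}\mathbb Z\times\dots\times\mathbb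 Z/p^{k_n}\mathbb Z$ and $\hat G=(\mathbb Z/p^{k_1}\mathbb Z)^n$, and let $\Psi:G^{\mathbb Z}\to\hat G^{\mathbb Z}$ be given by $(\Psi(c)_j)^i=p^{k_1-k_i}\,(c_j)^i$, where $h^i$ denotes the $i$-th component of $h$. Let $F$ be an additive CA over $G$ of radius $r$ with local rule $f$. For $-r\leq z\leq r$ and $g\in G$ let $f_z(g)$ be the value of $f$ at the word having $g$ at position $z$ and $0$ elsewhere. Let $L$ be the associated linear CA over $\hat G$, $L(b)_i=\sum_{z=-r}^{r}A_z\,b_{i+z}$, where $A_z\in(\mathbb Z/p^{k_1}\mathbb Z)^{n\times n}$ has entries $(A_z)_{i,j}=p^{k_j-k_i}f_z(e_j)^i$; here $e_j$ is the $j$-th standard generator of $G$, $f_z(e_j)^i$ is represented by an integer in $[0,p^{k_i})$, and the product is an integer that is reduced modulo $p^{k_1}$ (for $k_j<k_i$, the representative is divisible by $p^{k_i-k_j}$). Then $\Psi$ is injective, $L\circ\Psi=\Psi\circ F$, and $F$ is positively expansive if and only if $L$ is positively expansive. -/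

import Mathlib

namespace AdditiveCA

/-- The Tychonoff distance on bi-infinite configurations: `0` if `c = c'`, and otherwise
`2 ^ (-m)`, where `m` is the least `|j|` over the positions `j` at which `c` and `c'` differ. -/
noncomputable def tychonoffDist {S : Type*} (c c' : ℤ → S) : ℝ :=
  open Classical in
  if c = c' then 0 else (1 / 2 : ℝ) ^ sInf {m : ℕ | ∃ j : ℤ, j.natAbs = m ∧ c j ≠ c' j}

/-- The global rule of the one-dimensional cellular automaton of radius `r` with local rule `f`:
`F(c)_i = f(c_{i-r}, …, c_{i+r})`. The index `t : Fin (2 * r + 1)` stands for the offset `t - r`. -/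
def globalRule {S : Type*} (r : ℕ) (f : (Fin (2 * r + 1) → S) → S) (c : ℤ → S) : ℤ → S :=
  fun i => f fun t => c (i + ((t : ℕ) : ℤ) - (r : ℤ))

/-- Positive expansivity of a self-map of the configuration space. -/
def PositivelyExpansive {S : Type*} (F : (ℤ → S) → (ℤ → S)) : Prop :=
  ∃ ε : ℝ, 0 < ε ∧ ∀ c c' : ℤ → S, c ≠ c' → ∃ l : ℕ, ε ≤ tychonoffDist (F^[l] c) (F^[l] c')

/-- The cellular automaton with local rule `f` is additive: its global rule is an endomorphism
of the group of configurations. -/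
def IsAdditive {G : Type*} [AddCommGroup G] (r : ℕ) (f : (Fin (2 * r + 1) → G) → G) : Prop :=
  ∀ c c' : ℤ → G, globalRule r f (c + c') = globalRule r f c + globalRule r f c'

/-- Finite inputs of the decision problem: the number of elements of the group, its addition
table (row by row), the radius, and the table of the local rule. -/
abbrev Code : Type := ℕ × List (List ℕ) × ℕ × List ℕ

/-- The input presenting the group `G`, with its elements numbered by `e : G ≃ Fin q`, and the
local rule `f` of radius `r`. The table of `f` runs over all words of length `2 * r + 1`, the
`w`-th word consisting of the `2 * r + 1` digits of `w` in base `q`, least significant first. -/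
def encodeCA {G : Type*} [AddCommGroup G] {q : ℕ} (e : G ≃ Fin q) (r : ℕ)
    (f : (Fin (2 * r + 1) → G) → G) : Code :=
  (q,
    List.ofFn fun a : Fin q => List.ofFn fun b : Fin q => ((e (e.symm a + e.symm b) : Fin q) : ℕ),
    r,
    List.ofFn fun w : Fin (q ^ (2 * r + 1)) =>
      ((e (f fun t => e.symm (finFunctionFinEquiv.symm w t)) : Fin q) : ℕ))

/-- The linear local rule given by the matrices `A t`: `(x_t)_t ↦ ∑ t, A t * x t`. -/
def linearLocalRule {K : Type*} [CommRing K] {n : ℕ} (r : ℕ)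
    (A : Fin (2 * r + 1) → Matrix (Fin n) (Fin n) K) :
    (Fin (2 * r + 1) → Fin n → K) → Fin n → K :=
  fun x => ∑ t, (A t).mulVec (x t)

/-- The group `ℤ/p^{k_1} × ⋯ × ℤ/p^{k_n}`. -/
abbrev PGroup (p : ℕ) {n : ℕ} (k : Fin n → ℕ) : Type := (i : Fin n) → ZMod (p ^ k i)

/-- The map `ψ` from `ℤ/p^{k_1} × ⋯ × ℤ/p^{k_n}` to `(ℤ/p^{k_1})^n`,
`ψ(h)^i = p^{k_1 - k_i} h^i`. The first index is `0`, so `k_1` is `k 0`. -/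
def psi (p : ℕ) {n : ℕ} [NeZero n] (k : Fin n → ℕ) (h : PGroup p k) :
    Fin n → ZMod (p ^ k 0) :=
  fun i => (((h i).val * p ^ (k 0 - k i) : ℕ) : ZMod (p ^ k 0))

/-- The componentwise extension `Ψ` of `ψ` to configurations. -/
def bigPsi (p : ℕ) {n : ℕ} [NeZero n] (k : Fin n → ℕ) (c : ℤ → PGroup p k) :
    ℤ → Fin n → ZMod (p ^ k 0) :=
  fun j => psi p k (c j)

/-- The matrices `A_z = (p^{k_j - k_i} f_z(e_j)^i)_{i,j}` of the linear CA associated with an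
additive CA, where `f_z(g)` is the value of the local rule `f` at the word with `g` at offset `z`
and `0` elsewhere, and `f_z(e_j)^i` is represented by an integer in `[0, p^{k_i})`. With truncated
subtraction, at most one of the two powers of `p` below is not `1`: if `k_j < k_i` the entry is
the quotient of `f_z(e_j)^i` by `p^{k_i - k_j}`, which is exact when `f_z` is additive. -/
def assocMatrix (p : ℕ) {n : ℕ} [NeZero n] (k : Fin n → ℕ) (r : ℕ)
    (f : (Fin (2 * r + 1) → PGroup p k) → PGroup p k) (z : Fin (2 * r + 1)) :
    Matrix (Fin n) (Fin n) (ZMod (p ^ k 0)) :=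
  Matrix.of fun i j =>
    ((p ^ (k j - k i) * (f (Pi.single z (Pi.single j 1)) i).val / p ^ (k i - k j) : ℕ) :
      ZMod (p ^ k 0))

/-- The global rule of the linear CA over `(ℤ/p^{k_1})^n` associated with the additive CA with
local rule `f`. -/
def assocLCA (p : ℕ) {n : ℕ} [NeZero n] (k : Fin n → ℕ) (r : ℕ)
    (f : (Fin (2 * r + 1) → PGroup p k) → PGroup p k) :
    (ℤ → Fin n → ZMod (p ^ k 0)) → (ℤ → Fin n → ZMod (p ^ k 0)) :=
  globalRule r (linearLocalRule r (assocMatrix p k r f))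

end AdditiveCA

/-! By additivity, comparing two configurations amounts to comparing their difference with `0`, so
positive expansivity says that some finite window sees every nonzero orbit. A window of radius `r`
that stays zero forever is a wall that no information crosses, so the condition splits into one for
each half-line (`separates_iff_halfLine`). A nonzero configuration has a nonzero multiple of prime
order, so only the `p`-torsion matters, and compactness bounds the number of steps to be inspected
(`HalfLineSeparates.exists_shrinks`).

The `p`-torsion of `G` is a vector space over `ZMod p` of some dimension `n`. Its left-bounded
configurations are vectors of Laurent series in `X`, on which the automaton acts by a matrix `B`.
The crux is `Expands.finrank`: if any number of steps suffices, then `n` steps do. Expansion forces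
a power of `B⁻¹` to vanish modulo `X`. Hence the minimal polynomial of `B⁻¹` has power series
coefficients and is a power of the variable modulo `X`, which expresses `y` through its first `n`
iterates under `B` with coefficients divisible by `X`. Since `n ≤ |G|`, a failure of positive
expansivity is witnessed by a space-time diagram of explicitly bounded size, and a bounded search
decides the question.

For the second part, `Ψ` embeds the dynamics of `F` into that of `L`, so a window for `L` serves
`F`. Conversely the `p`-torsion of the large group lies in the image of `ψ`, and torsion is all that
matters. -/

namespace AdditiveCA

/-! ### Expanding matrices over Laurent series, and the bound by the dimension. -/

section Laurent

open Polynomial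

variable {k : Type*} [Field k] {n : ℕ}

/-- All coordinates of `y` have order at least `s`. -/
def OrdGE (s : ℤ) (y : Fin n → LaurentSeries k) : Prop :=
  ∀ i, ∀ j < s, (y i).coeff j = 0

lemma coeff_mul_eq_zero_of_lt {x y : LaurentSeries k} {a s : ℤ}
    (hx : ∀ j < a, x.coeff j = 0) (hy : ∀ j < s, y.coeff j = 0) :
    ∀ j < a + s, (x * y).coeff j = 0 := by
  intro j hj
  rw [HahnSeries.coeff_mul]
  refine Finset.sum_eq_zero fun ij hij => ?_
  rw [Finset.mem_antidiagonal] at hij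
  rcases lt_or_ge ij.1 a with h | h
  · rw [hx _ h, zero_mul]
  · rw [hy ij.2 (by omega), mul_zero]

lemma OrdGE.mono {s t : ℤ} (h : t ≤ s) {y : Fin n → LaurentSeries k} (hy : OrdGE s y) :
    OrdGE t y := fun i j hj => hy i j (hj.trans_le h)

lemma OrdGE.mulVec {B : Matrix (Fin n) (Fin n) (LaurentSeries k)} {a s : ℤ}
    {y : Fin n → LaurentSeries k}
    (hB : ∀ i l, ∀ j < a, (B i l).coeff j = 0) (hy : OrdGE s y) : OrdGE (a + s) (B.mulVec y) := by
  intro i j hj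
  simp only [Matrix.mulVec, dotProduct, HahnSeries.coeff_sum]
  exact Finset.sum_eq_zero fun l _ => coeff_mul_eq_zero_of_lt (hB i l) (hy l) j hj

lemma exists_ordGE (y : Fin n → LaurentSeries k) : ∃ s, OrdGE s y := by
  obtain ⟨s, hs⟩ := (Set.finite_range fun i => (y i).order).bddBelow
  exact ⟨s, fun i j hj => HahnSeries.coeff_eq_zero_of_lt_order (hj.trans_le (hs ⟨i, rfl⟩))⟩

lemma exists_coeff_matrix_eq_zero (B : Matrix (Fin n) (Fin n) (LaurentSeries k)) :
    ∃ a : ℤ, a ≤ 0 ∧ ∀ i l, ∀ j < a, (B i l).coeff j = 0 := by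
  obtain ⟨s, hs⟩ := (Set.finite_range fun p : Fin n × Fin n => (B p.1 p.2).order).bddBelow
  exact ⟨min s 0, min_le_right _ _, fun i l j hj => HahnSeries.coeff_eq_zero_of_lt_order
    ((hj.trans_le (min_le_left _ _)).trans_le (hs ⟨(i, l), rfl⟩))⟩

lemma ordGE_single_smul {s t : ℤ} {y : Fin n → LaurentSeries k} :
    OrdGE t (HahnSeries.single s (1 : k) • y) ↔ OrdGE (t - s) y := by
  have key : ∀ i j, ((HahnSeries.single s (1 : k) • y) i).coeff j = (y i).coeff (j - s) := by
    intro i j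
    rw [Pi.smul_apply, smul_eq_mul]
    simpa using HahnSeries.coeff_single_mul_add (r := (1 : k)) (x := y i) (a := j - s) (b := s)
  constructor
  · intro h i j hj
    have := h i (j + s) (by omega)
    rwa [key, add_sub_cancel_right] at this
  · intro h i j hj
    rw [key]
    exact h i _ (by omega)

lemma eq_zero_of_ordGE {y : Fin n → LaurentSeries k} (h : ∀ s, OrdGE s y) : y = 0 := by
  ext i j
  exact h (j + 1) i j (by omega)

/-- A vector whose iterates under `B`, up to the `L`-th, have order at least `0` is itself of
order at least `1`. -/
def Expands (B : Matrix (Fin n) (Fin n) (LaurentSeries k)) (L : ℕ) : Prop :=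
  ∀ y, (∀ i ≤ L, OrdGE 0 ((B ^ i).mulVec y)) → OrdGE 1 y

variable {B : Matrix (Fin n) (Fin n) (LaurentSeries k)} {L : ℕ}

lemma Expands.ordGE (hB : Expands B L) {y : Fin n → LaurentSeries k} {s : ℤ}
    (h : ∀ i ≤ L, OrdGE s ((B ^ i).mulVec y)) : OrdGE (s + 1) y := by
  have := hB (HahnSeries.single (-s) (1 : k) • y) fun i hi => by
    rw [Matrix.mulVec_smul, ordGE_single_smul]
    simpa using h i hi
  rw [ordGE_single_smul] at this
  exact this.mono (by omega)

/-- The assumption on `y` itself (`i = 0`) can be dropped: `y` has some order, and each use of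
expansion raises the known lower bound by one until it reaches `m + 1`. -/
lemma Expands.ordGE_of_pos (hB : Expands B L) {y : Fin n → LaurentSeries k} {m : ℤ}
    (h : ∀ i ≤ L, i ≠ 0 → OrdGE m ((B ^ i).mulVec y)) : OrdGE (m + 1) y := by
  obtain ⟨s, hs⟩ := exists_ordGE y
  have key : ∀ t : ℕ, OrdGE (min (s + t) (m + 1)) y := by
    intro t
    induction t with
    | zero => exact hs.mono (by simp)
    | succ t ih =>
      refine (hB.ordGE (s := min (s + t) m) fun i hi => ?_).mono (by push_cast; omega)
      rcases Nat.eq_zero_or_pos i with rfl | h0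
      · rw [pow_zero, Matrix.one_mulVec]
        exact ih.mono (by omega)
      · exact (h i hi h0.ne').mono (by omega)
  exact (key (m + 1 - s).toNat).mono (by omega)

/-- The positive iterates of a kernel vector vanish, so they have every order, and then so does the
vector. -/
lemma Expands.isUnit (hB : Expands B L) : IsUnit B := by
  rw [← Matrix.mulVec_injective_iff_isUnit]
  rw [← Matrix.coe_mulVecLin, injective_iff_map_eq_zero]
  intro y hy
  rw [Matrix.mulVecLin_apply] at hy
  refine eq_zero_of_ordGE fun s => ?_
  refine (hB.ordGE_of_pos (m := s) fun i _ h0 => ?_).mono (by omega)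
  obtain ⟨i, rfl⟩ := Nat.exists_eq_succ_of_ne_zero h0
  rw [pow_succ, ← Matrix.mulVec_mulVec, hy, Matrix.mulVec_zero]
  intro _ _ _
  rfl

/-- Read backwards in time, expansion is contraction: this produces a power of `B⁻¹` that vanishes
modulo `X`. -/
lemma Expands.exists_pow_inv (hB : Expands B L) :
    ∃ T : ℕ, T ≠ 0 ∧ ∀ y, OrdGE 0 y → OrdGE 1 ((B⁻¹ ^ T).mulVec y) := by
  obtain ⟨a, ha0, ha⟩ := exists_coeff_matrix_eq_zero B⁻¹
  have hdet := (Matrix.isUnit_iff_isUnit_det B).1 hB.isUnit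
  have h1 : ∀ (i : ℕ) (y : Fin n → LaurentSeries k), OrdGE 0 y →
      OrdGE (a * i) ((B⁻¹ ^ i).mulVec y) := by
    intro i y hy
    induction i with
    | zero => simpa using hy
    | succ i ih =>
      rw [pow_succ', ← Matrix.mulVec_mulVec]
      exact (ih.mulVec ha).mono (by push_cast; linarith)
  -- For `l ≤ L` the image of `B⁻¹ ^ i y` under `B ^ l` is an earlier inverse iterate, so
  -- `ordGE_of_pos` gains one order every `L + 1` steps. The term `a * (L + 1)` is the most that the
  -- initial steps can lose, by `h1`.
  have h2 : ∀ (i : ℕ) (y : Fin n → LaurentSeries k), OrdGE 0 y →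
      OrdGE (((i / (L + 1) : ℕ) : ℤ) + a * (L + 1)) ((B⁻¹ ^ i).mulVec y) := by
    intro i y hy
    induction i using Nat.strong_induction_on with
    | _ i ih =>
      rcases Nat.lt_or_ge i (L + 1) with hi | hi
      · rw [Nat.div_eq_of_lt hi]
        refine (h1 i y hy).mono ?_
        push_cast
        rw [zero_add]
        exact mul_le_mul_of_nonpos_left (by exact_mod_cast hi.le) ha0
      · obtain ⟨j, rfl⟩ := Nat.exists_eq_add_of_le' hi
        rw [Nat.add_div_right _ (Nat.succ_pos L)]
        refine (hB.ordGE_of_pos (m := ((j / (L + 1) : ℕ) : ℤ) + a * (L + 1))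
          fun l hl h0 => ?_).mono (by push_cast; omega)
        have e : (B ^ l).mulVec ((B⁻¹ ^ (j + (L + 1))).mulVec y) =
            (B⁻¹ ^ (j + (L + 1) - l)).mulVec y := by
          rw [Matrix.mulVec_mulVec]
          congr 1
          obtain ⟨d, hd⟩ := Nat.exists_eq_add_of_le (show l ≤ j + (L + 1) by omega)
          rw [hd, Nat.add_sub_cancel_left, pow_add, ← mul_assoc, Matrix.inv_pow',
            Matrix.mul_nonsing_inv _ (by rw [Matrix.det_pow]; exact hdet.pow l), one_mul]
        rw [e]
        refine (ih _ (by omega)).mono ?_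
        have : j / (L + 1) ≤ (j + (L + 1) - l) / (L + 1) := Nat.div_le_div_right (by omega)
        omega
  -- Dividing this exponent by `L + 1` leaves `1 - a * (L + 1)`, which lifts the bound of `h2` to
  -- exactly `1`.
  refine ⟨(L + 1) * (1 - a * (L + 1)).toNat, ?_, fun y hy => (h2 _ y hy).mono ?_⟩
  · have := mul_nonpos_of_nonpos_of_nonneg ha0 (show (0 : ℤ) ≤ L + 1 by positivity)
    exact mul_ne_zero (Nat.succ_ne_zero L) (by omega)
  rw [Nat.mul_div_cancel_left _ (Nat.succ_pos L)]
  omega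

lemma exists_powerSeries {x : LaurentSeries k} (hx : ∀ j < 1, x.coeff j = 0) :
    ∃ u : PowerSeries k, PowerSeries.constantCoeff u = 0 ∧
      algebraMap (PowerSeries k) (LaurentSeries k) u = x := by
  refine ⟨PowerSeries.mk fun m => x.coeff m, ?_, ?_⟩
  · rw [← PowerSeries.coeff_zero_eq_constantCoeff_apply, PowerSeries.coeff_mk]
    exact hx _ (by norm_num)
  · ext j
    rw [LaurentSeries.coe_algebraMap]
    rcases lt_or_ge j 0 with hj | hj
    · rw [hx j (by omega)]
      exact (PowerSeries.coeff_coe _ j).trans (if_pos hj)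
    · obtain ⟨m, rfl⟩ := Int.eq_ofNat_of_zero_le hj
      refine (PowerSeries.coeff_coe _ _).trans ?_
      simp

lemma coeff_algebraMap_eq_zero {u : PowerSeries k} (hu : PowerSeries.constantCoeff u = 0) :
    ∀ j < 1, (algebraMap (PowerSeries k) (LaurentSeries k) u).coeff j = 0 := by
  intro j hj
  rw [LaurentSeries.coe_algebraMap]
  refine (PowerSeries.coeff_coe u j).trans ?_
  split_ifs with h
  · rfl
  · obtain rfl : j = 0 := by omega
    simpa using hu

/-- The characteristic polynomial of `A ^ T`, expanded by `T`, is monic over power series and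
annihilates `A`. Power series are integrally closed, so the minimal polynomial of `A` is defined
over them too, and its degree is at most `n` by Cayley-Hamilton. -/
lemma exists_annihilating_polynomial {A : Matrix (Fin n) (Fin n) (LaurentSeries k)} {T : ℕ} (hT : T ≠ 0)
    (hA : ∀ i l, ∀ j < 1, ((A ^ T) i l).coeff j = 0) :
    ∃ m : (PowerSeries k)[X], m.Monic ∧ m.natDegree ≤ n ∧
      (∀ i < m.natDegree, PowerSeries.constantCoeff (m.coeff i) = 0) ∧
      Polynomial.aeval A (m.map (algebraMap (PowerSeries k) (LaurentSeries k))) = 0 := by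
  choose C hC0 hC using fun i l => exists_powerSeries (hA i l)
  set φ := algebraMap (PowerSeries k) (LaurentSeries k) with hφ
  let C' : Matrix (Fin n) (Fin n) (PowerSeries k) := Matrix.of C
  have hCA : C'.map φ = A ^ T := by ext1 i l; exact hC i l
  have hh : (expand _ T C'.charpoly).Monic := C'.charpoly_monic.expand (Nat.pos_of_ne_zero hT)
  have hann : Polynomial.aeval A ((expand _ T C'.charpoly).map φ) = 0 := by
    rw [map_expand, expand_aeval, ← Matrix.charpoly_map, hCA]
    exact Matrix.aeval_self_charpoly _
  have hdvd := minpoly.dvd (LaurentSeries k) A hann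
  obtain ⟨m, hm⟩ := IsIntegrallyClosed.eq_map_mul_C_of_dvd (LaurentSeries k) hh hdvd
  have hmin := minpoly.monic (Algebra.IsIntegral.isIntegral (R := LaurentSeries k) A)
  rw [hmin.leadingCoeff, C_1, mul_one] at hm
  have hinj : Function.Injective φ := IsFractionRing.injective _ _
  have hmonic : m.Monic := hinj.monic_map_iff.2 (hm ▸ hmin)
  have hdeg : m.natDegree ≤ n := by
    rw [← hmonic.natDegree_map φ, hm]
    refine (natDegree_le_of_dvd (Matrix.minpoly_dvd_charpoly A) A.charpoly_monic.ne_zero).trans ?_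
    rw [Matrix.charpoly_natDegree_eq_dim, Fintype.card_fin]
  refine ⟨m, hmonic, hdeg, ?_, ?_⟩
  · have h1 : m ∣ expand _ T C'.charpoly := by
      rw [← hm] at hdvd
      exact (map_dvd_map φ hinj hmonic).1 hdvd
    -- Modulo `X` the matrix `C'` is zero, so the expanded characteristic polynomial becomes a power
    -- of the variable, and so does its monic divisor `m`.
    have h2 : C'.map (PowerSeries.constantCoeff (R := k)) = 0 := by ext1 i l; exact hC0 i l
    have h3 := map_dvd (mapRingHom (PowerSeries.constantCoeff (R := k))) h1
    rw [coe_mapRingHom, map_expand, ← Matrix.charpoly_map, h2, Matrix.charpoly_zero, map_pow,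
      expand_X, ← pow_mul] at h3
    obtain ⟨d, -, hd⟩ := (dvd_prime_pow prime_X _).1 h3
    have h4 := eq_of_monic_of_associated (hmonic.map _) (monic_X_pow d) hd
    intro i hi
    rw [← coeff_map, h4, coeff_X_pow, if_neg]
    rintro rfl
    rw [← hmonic.natDegree_map (PowerSeries.constantCoeff (R := k)), h4, natDegree_X_pow] at hi
    exact hi.ne rfl
  · rw [hm, minpoly.aeval]

lemma Expands.finrank (hB : Expands B L) : Expands B n := by
  obtain ⟨T, hT0, hT⟩ := hB.exists_pow_inv
  have hdet := (Matrix.isUnit_iff_isUnit_det B).1 hB.isUnit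
  obtain ⟨m, hm, hdeg, hcoeff, hann⟩ := exists_annihilating_polynomial (A := B⁻¹) hT0 <| by
    intro i l j hj
    have := hT (Pi.single l 1) (fun i' j' hj' => by
      rcases eq_or_ne i' l with rfl | h
      · rw [Pi.single_eq_same, HahnSeries.coeff_one, if_neg hj'.ne]
      · rw [Pi.single_eq_of_ne h, HahnSeries.coeff_zero]) i j hj
    simpa using this
  intro y hy
  rw [Polynomial.aeval_eq_sum_range, hm.natDegree_map, Finset.sum_range_succ] at hann
  have h1 : B ^ m.natDegree * B⁻¹ ^ m.natDegree = 1 := by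
    rw [Matrix.inv_pow', Matrix.mul_nonsing_inv _ (by rw [Matrix.det_pow]; exact hdet.pow _)]
  -- The relation for `B⁻¹`, multiplied by `B` to the degree of `m`, isolates `y`; every other term
  -- is an iterate of order at least `0` times a series without constant term.
  have h2 : y = -∑ i ∈ Finset.range m.natDegree,
      algebraMap (PowerSeries k) (LaurentSeries k) (m.coeff i) •
        (B ^ (m.natDegree - i)).mulVec y := by
    have := congrArg (fun Z => (B ^ m.natDegree * Z).mulVec y) hann
    simp only [coeff_map, hm.coeff_natDegree, map_one, one_smul, mul_add, h1, mul_zero,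
      Matrix.zero_mulVec, Matrix.add_mulVec, Matrix.one_mulVec] at this
    rw [add_comm] at this
    refine (eq_neg_of_add_eq_zero_left this).trans ?_
    rw [Finset.mul_sum, Matrix.sum_mulVec]
    congr 1
    refine Finset.sum_congr rfl fun i hi => ?_
    rw [Matrix.mul_smul, Matrix.smul_mulVec]
    congr 2
    rw [Finset.mem_range] at hi
    obtain ⟨d, hd⟩ := Nat.exists_eq_add_of_le' hi.le
    rw [hd, Nat.add_sub_cancel, pow_add, mul_assoc, Matrix.inv_pow',
      Matrix.mul_nonsing_inv _ (by rw [Matrix.det_pow]; exact hdet.pow _), mul_one]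
  rw [h2]
  intro i j hj
  rw [Pi.neg_apply, HahnSeries.coeff_neg, Finset.sum_apply, HahnSeries.coeff_sum, neg_eq_zero]
  refine Finset.sum_eq_zero fun l hl => ?_
  rw [Finset.mem_range] at hl
  rw [Pi.smul_apply, smul_eq_mul]
  exact coeff_mul_eq_zero_of_lt (coeff_algebraMap_eq_zero (hcoeff l hl))
    (hy (m.natDegree - l) (by omega) i) j (by simpa using hj)

end Laurent

/-! ### Reduction to half-lines, to prime torsion and to finitely many steps. -/

section Separation

lemma pow_le_tychonoffDist_iff {S : Type*} {c c' : ℤ → S} {m : ℕ} :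
    (1 / 2 : ℝ) ^ m ≤ tychonoffDist c c' ↔ ∃ j : ℤ, j.natAbs ≤ m ∧ c j ≠ c' j := by
  unfold tychonoffDist
  split_ifs with h
  · subst h
    simp only [ne_eq, not_true_eq_false, and_false, exists_false, iff_false, not_le]
    positivity
  · rw [pow_le_pow_iff_right_of_lt_one₀ (by norm_num) (by norm_num)]
    obtain ⟨j₀, hj₀⟩ := Function.ne_iff.1 h
    constructor
    · intro hm
      have hs : {m : ℕ | ∃ j : ℤ, j.natAbs = m ∧ c j ≠ c' j}.Nonempty := ⟨_, j₀, rfl, hj₀⟩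
      obtain ⟨j, hj, hne⟩ := Nat.sInf_mem hs
      exact ⟨j, hj.trans_le hm, hne⟩
    · rintro ⟨j, hj, hne⟩
      exact (Nat.sInf_le (show j.natAbs ∈ {m : ℕ | ∃ j : ℤ, j.natAbs = m ∧ c j ≠ c' j} from
        ⟨j, rfl, hne⟩)).trans hj

variable {G : Type*} [AddCommGroup G]

/-- Some finite window detects every nonzero configuration along its orbit. -/
def Separates (F : (ℤ → G) → (ℤ → G)) : Prop :=
  ∃ m : ℕ, ∀ c : ℤ → G, (∀ l : ℕ, ∀ j : ℤ, j.natAbs ≤ m → F^[l] c j = 0) → c = 0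

lemma positivelyExpansive_iff_separates (Φ : (ℤ → G) →+ (ℤ → G)) :
    PositivelyExpansive Φ ↔ Separates Φ := by
  constructor
  · rintro ⟨ε, hε, h⟩
    obtain ⟨m, hm⟩ := exists_pow_lt_of_lt_one hε (show (1 / 2 : ℝ) < 1 by norm_num)
    refine ⟨m, fun c hc => by_contra fun hne => ?_⟩
    obtain ⟨l, hl⟩ := h c 0 hne
    obtain ⟨j, hj, hj'⟩ := pow_le_tychonoffDist_iff.1 (hm.le.trans hl)
    rw [iterate_map_zero] at hj'
    exact hj' (hc l j hj)
  · rintro ⟨m, h⟩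
    refine ⟨(1 / 2) ^ m, by positivity, fun c c' hne => ?_⟩
    by_contra! hcon
    refine hne (sub_eq_zero.1 (h (c - c') fun l j hj => ?_))
    rw [iterate_map_sub, Pi.sub_apply, sub_eq_zero]
    by_contra hj'
    exact (hcon l).not_ge (pow_le_tychonoffDist_iff.2 ⟨j, hj, hj'⟩)

variable {r : ℕ} {f : (Fin (2 * r + 1) → G) → G}

/-- The global rule of an additive local rule, as a homomorphism. -/
def caHom (hf : IsAdditive r f) : (ℤ → G) →+ (ℤ → G) :=
  AddMonoidHom.mk' (globalRule r f) hf

@[simp]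
lemma coe_caHom (hf : IsAdditive r f) : ⇑(caHom hf) = globalRule r f := rfl

lemma globalRule_iterate_smul (hf : IsAdditive r f) (l m : ℕ) (c : ℤ → G) :
    (globalRule r f)^[l] (m • c) = m • (globalRule r f)^[l] c :=
  (Function.Commute.iterate_left (f := globalRule r f) (g := fun c => m • c)
    (fun c => map_nsmul (caHom hf) m c) l).eq c

lemma globalRule_iterate_shift {S : Type*} {r : ℕ} (f : (Fin (2 * r + 1) → S) → S) (a : ℤ)
    (l : ℕ) (c : ℤ → S) :
    (globalRule r f)^[l] (fun j => c (j + a)) = fun j => (globalRule r f)^[l] c (j + a) := by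
  induction l with
  | zero => rfl
  | succ l ih =>
    rw [Function.iterate_succ_apply', Function.iterate_succ_apply', ih]
    funext j
    refine congrArg f (funext fun t => congrArg ((globalRule r f)^[l] c) ?_)
    ring

/-- The local rule with the two directions of the line exchanged. -/
def revRule {S : Type*} {r : ℕ} (f : (Fin (2 * r + 1) → S) → S) :
    (Fin (2 * r + 1) → S) → S :=
  fun w => f fun t => w t.rev

lemma globalRule_revRule {S : Type*} {r : ℕ} (f : (Fin (2 * r + 1) → S) → S) (c : ℤ → S) :
    globalRule r (revRule f) (fun j => c (-j)) = fun j => globalRule r f c (-j) := by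
  funext j
  simp only [globalRule, revRule]
  congr 1
  funext t
  congr 1
  rw [Fin.val_rev]
  have := t.2
  omega

lemma globalRule_revRule_iterate {S : Type*} {r : ℕ} (f : (Fin (2 * r + 1) → S) → S) (l : ℕ)
    (c : ℤ → S) :
    (globalRule r (revRule f))^[l] (fun j => c (-j)) =
      fun j => (globalRule r f)^[l] c (-j) := by
  induction l with
  | zero => rfl
  | succ l ih =>
    rw [Function.iterate_succ_apply', Function.iterate_succ_apply', ih, globalRule_revRule]

lemma revRule_revRule {S : Type*} {r : ℕ} (f : (Fin (2 * r + 1) → S) → S) :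
    revRule (revRule f) = f := by
  funext w
  simp [revRule]

lemma IsAdditive.revRule (hf : IsAdditive r f) : IsAdditive r (revRule f) := by
  have e : ∀ c : ℤ → G, globalRule r (AdditiveCA.revRule f) c =
      fun j => globalRule r f (fun j => c (-j)) (-j) := fun c => by
    rw [← globalRule_revRule]
    simp
  intro c c'
  rw [e, e, e]
  funext j
  exact congrFun (hf (fun j => c (-j)) fun j => c' (-j)) (-j)

lemma Separates.revRule (h : Separates (globalRule r f)) :
    Separates (globalRule r (revRule f)) := by
  obtain ⟨m, h⟩ := h
  refine ⟨m, fun c hc => ?_⟩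
  have := h (fun j => c (-j)) fun l j hj => by
    rw [← revRule_revRule f, globalRule_revRule_iterate]
    exact hc l (-j) (by simpa using hj)
  funext j
  simpa using congrFun this (-j)

/-- No nonzero configuration has its whole orbit supported in the nonnegative half-line. -/
def HalfLineSeparates (F : (ℤ → G) → (ℤ → G)) : Prop :=
  ∀ c : ℤ → G, (∀ l : ℕ, ∀ j < 0, F^[l] c j = 0) → c = 0

/-- Shifting to the right by `m + 1` moves the whole window into the part of the line where the
orbit vanishes. -/
lemma Separates.halfLine (h : Separates (globalRule r f)) :
    HalfLineSeparates (globalRule r f) := by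
  obtain ⟨m, h⟩ := h
  intro c hc
  have := h (fun j => c (j + (-(m + 1 : ℕ)))) fun l j hj => by
    rw [globalRule_iterate_shift]
    exact hc l _ (by omega)
  funext j
  have := congrFun this (j + (m + 1 : ℕ))
  simpa only [add_neg_cancel_right, Pi.zero_apply] using this

lemma globalRule_zero (hf : IsAdditive r f) : globalRule r f 0 = 0 := map_zero (caHom hf)

lemma localRule_zero (hf : IsAdditive r f) : f 0 = 0 := congrFun (globalRule_zero hf) 0

/-- Restriction to the positive half-line commutes with the global rule on configurations that
vanish near the origin. -/
lemma globalRule_indicator (hf : IsAdditive r f) {c : ℤ → G}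
    (hc : ∀ j : ℤ, j.natAbs ≤ r → c j = 0) :
    globalRule r f (fun j => if 0 < j then c j else 0) =
      fun j => if 0 < j then globalRule r f c j else 0 := by
  funext j
  split_ifs with hj
  · simp only [globalRule]
    congr 1
    funext t
    split_ifs with h
    · rfl
    · exact (hc _ (by omega)).symm
  · simp only [globalRule]
    refine Eq.trans ?_ (localRule_zero hf)
    congr 1
    funext t
    have := t.2
    split_ifs with h
    · exact hc _ (by omega)
    · rfl

/-- Behind the wall of zeros around the origin, the positive half of `c` evolves on its own, and its
orbit never enters the negative half-line. -/
lemma HalfLineSeparates.eq_zero_of_pos (hf : IsAdditive r f)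
    (h : HalfLineSeparates (globalRule r f)) {c : ℤ → G}
    (hc : ∀ l : ℕ, ∀ j : ℤ, j.natAbs ≤ r → (globalRule r f)^[l] c j = 0) {j : ℤ} (hj : 0 < j) :
    c j = 0 := by
  have key : ∀ l : ℕ, (globalRule r f)^[l] (fun j => if 0 < j then c j else 0) =
      fun j => if 0 < j then (globalRule r f)^[l] c j else 0 := by
    intro l
    induction l with
    | zero => rfl
    | succ l ih =>
      rw [Function.iterate_succ_apply', ih, globalRule_indicator hf (hc l)]
      rw [Function.iterate_succ_apply']
  have := congrFun (h (fun j => if 0 < j then c j else 0) fun l j hj => by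
    rw [key]
    exact if_neg hj.not_gt) j
  simpa [hj] using this

lemma separates_iff_halfLine (hf : IsAdditive r f) :
    Separates (globalRule r f) ↔
      HalfLineSeparates (globalRule r f) ∧ HalfLineSeparates (globalRule r (revRule f)) := by
  refine ⟨fun h => ⟨h.halfLine, h.revRule.halfLine⟩, fun ⟨h, h'⟩ => ⟨r, fun c hc => ?_⟩⟩
  funext j
  rcases lt_trichotomy j 0 with hj | rfl | hj
  · have := h'.eq_zero_of_pos hf.revRule (c := fun j => c (-j)) (fun l j hj => by
      rw [globalRule_revRule_iterate]
      exact hc l _ (by simpa using hj)) (j := -j) (by omega)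
    simpa using this
  · exact hc 0 0 (by simp)
  · exact h.eq_zero_of_pos hf hc hj

/-- A `p`-torsion configuration whose first `N` iterates vanish on the negative half-line
vanishes at the origin. -/
def Shrinks (F : (ℤ → G) → (ℤ → G)) (p N : ℕ) : Prop :=
  ∀ c : ℤ → G, p • c = 0 → (∀ i ≤ N, ∀ j < 0, F^[i] c j = 0) → c 0 = 0

/-- A nonzero torsion element has a nonzero multiple of prime order. -/
lemma exists_prime_nsmul {M : Type*} [AddCommGroup M] {N : ℕ} (hN : N ≠ 0) {c : M}
    (hc : N • c = 0) (hne : c ≠ 0) : ∃ p m : ℕ, p.Prime ∧ p • m • c = 0 ∧ m • c ≠ 0 := by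
  have h0 : addOrderOf c ≠ 0 := fun h =>
    hN (Nat.eq_zero_of_zero_dvd (h ▸ addOrderOf_dvd_of_nsmul_eq_zero hc))
  have h1 : addOrderOf c ≠ 1 := fun h => hne (AddMonoid.addOrderOf_eq_one_iff.1 h)
  obtain ⟨p, hp, m, hm⟩ := Nat.exists_prime_and_dvd h1
  refine ⟨p, m, hp, ?_, fun h => ?_⟩
  · rw [← mul_nsmul', ← hm, addOrderOf_nsmul_eq_zero]
  · have h2 := Nat.le_of_dvd (Nat.pos_of_ne_zero (by rintro rfl; simp_all))
      (addOrderOf_dvd_of_nsmul_eq_zero h)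
    have h3 := hp.two_le
    have h4 : m ≠ 0 := by rintro rfl; simp_all
    nlinarith [Nat.pos_of_ne_zero h4]

lemma HalfLineSeparates.of_shrinks [Finite G] (hf : IsAdditive r f)
    (h : ∀ p : ℕ, p.Prime → ∃ N, Shrinks (globalRule r f) p N) :
    HalfLineSeparates (globalRule r f) := by
  intro c hc
  by_contra hne
  obtain ⟨p, m, hp, hpc, hmc⟩ := exists_prime_nsmul (N := Nat.card G) Nat.card_pos.ne'
    (funext fun j => card_nsmul_eq_zero') hne
  obtain ⟨N, hN⟩ := h p hp
  -- The vanishing region grows one cell at a time: `Shrinks` is applied to the whole orbit, shifted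
  -- so that cell `s` becomes the origin.
  have key : ∀ s : ℕ, ∀ l : ℕ, ∀ j < (s : ℤ), (globalRule r f)^[l] (m • c) j = 0 := by
    intro s
    induction s with
    | zero =>
      intro l j hj
      rw [globalRule_iterate_smul hf, Pi.smul_apply, hc l j (by exact_mod_cast hj), smul_zero]
    | succ s ih =>
      intro l j hj
      rcases lt_or_ge j (s : ℤ) with h | h
      · exact ih l j h
      · obtain rfl : j = s := by push_cast at hj; omega
        have := hN (fun j => (globalRule r f)^[l] (m • c) (j + s)) (by
          funext j
          rw [Pi.smul_apply, ← Pi.smul_apply p, ← globalRule_iterate_smul hf, hpc]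
          exact congrFun (iterate_map_zero (caHom hf) l) _) fun i _ j hj => by
            rw [globalRule_iterate_shift, ← Function.iterate_add_apply]
            exact ih _ _ (by omega)
        simpa using this
  refine hmc (funext fun j => ?_)
  exact key (j + 1).toNat 0 j (by omega)

/-- Compactness: counterexamples for every `L` form a decreasing sequence of nonempty closed sets,
and a common point contradicts half-line separation. -/
lemma HalfLineSeparates.exists_shrinks [Finite G]
    (h : HalfLineSeparates (globalRule r f)) (p : ℕ) : ∃ L, Shrinks (globalRule r f) p L := by
  let _ : TopologicalSpace G := ⊥
  have : DiscreteTopology G := ⟨rfl⟩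
  have hcont : Continuous (globalRule r f) :=
    continuous_pi fun i => (continuous_of_discreteTopology (f := f)).comp
      (continuous_pi fun t => continuous_apply _)
  by_contra! hcon
  let K : ℕ → Set (ℤ → G) := fun L =>
    {c | c 0 ≠ 0} ∩ ⋂ i ∈ Set.Iic L, ⋂ j ∈ Set.Iio (0 : ℤ), {c | (globalRule r f)^[i] c j = 0}
  have hclosed : ∀ L, IsClosed (K L) := fun L =>
    ((isClosed_discrete {x : G | x ≠ 0}).preimage
      (continuous_apply (A := fun _ : ℤ => G) 0)).inter <|
      isClosed_biInter fun i _ => isClosed_biInter fun j _ =>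
        (isClosed_discrete {0}).preimage ((continuous_apply j).comp (hcont.iterate i))
  obtain ⟨c, hc⟩ := IsCompact.nonempty_iInter_of_sequence_nonempty_isCompact_isClosed K
    (fun L => Set.inter_subset_inter_right _ <| Set.biInter_subset_biInter_left <|
      Set.Iic_subset_Iic.2 L.le_succ)
    (fun L => by
      have := hcon L
      unfold Shrinks at this
      push Not at this
      obtain ⟨c, -, hc, h0⟩ := this
      exact ⟨c, h0, by simpa using hc⟩)
    (hclosed 0).isCompact hclosed
  rw [Set.mem_iInter] at hc
  refine (hc 0).1 (congrFun (h c fun l j hj => ?_) 0)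
  have := (hc l).2
  simp only [Set.mem_iInter] at this
  exact this l (Set.mem_Iic.2 le_rfl) j hj

end Separation

/-! ### The action on prime torsion as a matrix of Laurent polynomials. -/

section TorsionSeries

variable {G : Type*} [AddCommGroup G] {r : ℕ} {f : (Fin (2 * r + 1) → G) → G}

lemma localRule_add (hf : IsAdditive r f) (w w' : Fin (2 * r + 1) → G) :
    f (w + w') = f w + f w' := by
  -- For `j < -r` the truncation in `toNat` makes this `w 0` rather than `0`; this is harmless,
  -- since only cells in `[-r, r]` are read and `ext` is still additive in `w`.
  let ext (w : Fin (2 * r + 1) → G) (j : ℤ) : G :=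
    if h : (j + r).toNat < 2 * r + 1 then w ⟨(j + r).toNat, h⟩ else 0
  have hext : ∀ w, globalRule r f (ext w) 0 = f w := by
    intro w
    simp only [globalRule]
    congr 1
    funext t
    have : (0 + ((t : ℕ) : ℤ) - r + r).toNat = t := by omega
    simp only [ext, this]
    exact dif_pos t.2
  rw [← hext w, ← hext w', ← hext (w + w'), ← Pi.add_apply, ← hf]
  congr 1
  funext j
  simp only [ext, Pi.add_apply]
  split_ifs
  · rfl
  · rw [add_zero]

/-- The summand of an additive local rule belonging to one position of the word. -/
def localPart (hf : IsAdditive r f) (t : Fin (2 * r + 1)) : G →+ G :=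
  (AddMonoidHom.mk' f (localRule_add hf)).comp (AddMonoidHom.single (fun _ => G) t)

lemma localPart_apply (hf : IsAdditive r f) (t : Fin (2 * r + 1)) (g : G) :
    localPart hf t g = f (Pi.single t g) := rfl

lemma localRule_eq_sum (hf : IsAdditive r f) (w : Fin (2 * r + 1) → G) :
    f w = ∑ t, localPart hf t (w t) := by
  conv_lhs => rw [← Finset.univ_sum_single w]
  exact map_sum (AddMonoidHom.mk' f (localRule_add hf)) _ _

/-- The subgroup of `p`-torsion elements. -/
abbrev pTorsion (G : Type*) [AddCommGroup G] (p : ℕ) : AddSubgroup G :=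
  (nsmulAddMonoidHom (α := G) p).ker

lemma nsmul_pTorsion (p : ℕ) (v : pTorsion G p) : p • v = 0 :=
  Subtype.ext v.2

/-- The `p`-torsion as a vector space over the prime field. -/
abbrev pTorsionModule (G : Type*) [AddCommGroup G] (p : ℕ) : Module (ZMod p) (pTorsion G p) :=
  AddCommGroup.zmodModule (nsmul_pTorsion p)

attribute [local instance] pTorsionModule

/-- The restriction of a summand of the local rule to the `p`-torsion. -/
def torsionPart (hf : IsAdditive r f) (p : ℕ) (t : Fin (2 * r + 1)) :
    pTorsion G p →ₗ[ZMod p] pTorsion G p :=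
  (((localPart hf t).comp (pTorsion G p).subtype).codRestrict (pTorsion G p) fun v => by
    rw [AddMonoidHom.mem_ker, nsmulAddMonoidHom_apply, ← map_nsmul,
      nsmul_pTorsion, map_zero]).toZModLinearMap p

lemma coe_torsionPart (hf : IsAdditive r f) (p : ℕ) (t : Fin (2 * r + 1)) (v : pTorsion G p) :
    (torsionPart hf p t v : G) = localPart hf t v := rfl

variable {p n : ℕ} [Fact p.Prime]

/-- The configuration over the `p`-torsion given by a vector of Laurent series. -/
noncomputable def seriesConfig (b : Module.Basis (Fin n) (ZMod p) (pTorsion G p))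
    (y : Fin n → LaurentSeries (ZMod p)) (j : ℤ) : G :=
  (b.equivFun.symm fun i => (y i).coeff j : pTorsion G p)

lemma seriesConfig_eq_zero_iff (b : Module.Basis (Fin n) (ZMod p) (pTorsion G p))
    (y : Fin n → LaurentSeries (ZMod p)) (j : ℤ) :
    seriesConfig b y j = 0 ↔ ∀ i, (y i).coeff j = 0 := by
  rw [seriesConfig, ZeroMemClass.coe_eq_zero, LinearEquiv.map_eq_zero_iff]
  exact funext_iff

lemma ordGE_iff_seriesConfig (b : Module.Basis (Fin n) (ZMod p) (pTorsion G p))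
    (y : Fin n → LaurentSeries (ZMod p)) (s : ℤ) :
    OrdGE s y ↔ ∀ j < s, seriesConfig b y j = 0 := by
  simp only [seriesConfig_eq_zero_iff]
  exact ⟨fun h j hj i => h i j hj, fun h i j hj => h j hj i⟩

lemma nsmul_seriesConfig (b : Module.Basis (Fin n) (ZMod p) (pTorsion G p))
    (y : Fin n → LaurentSeries (ZMod p)) : p • seriesConfig b y = 0 :=
  funext fun j => (b.equivFun.symm fun i => (y i).coeff j : pTorsion G p).2

lemma exists_seriesConfig_eq (b : Module.Basis (Fin n) (ZMod p) (pTorsion G p)) {c : ℤ → G}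
    (hc : p • c = 0) (h0 : ∀ j < 0, c j = 0) : ∃ y, seriesConfig b y = c := by
  let v : ℤ → pTorsion G p := fun j => ⟨c j, congrFun hc j⟩
  refine ⟨fun i => HahnSeries.ofSuppBddBelow (fun j => b.equivFun (v j) i) ⟨0, fun j hj => ?_⟩, ?_⟩
  · by_contra! hneg
    have : v j = 0 := Subtype.ext (h0 j hneg)
    exact hj (by simp [this])
  · funext j
    exact congrArg Subtype.val (b.equivFun.symm_apply_apply (v j))

/-- The matrix of Laurent polynomials by which the automaton acts on the `p`-torsion. -/
noncomputable def seriesMatrix (hf : IsAdditive r f)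
    (b : Module.Basis (Fin n) (ZMod p) (pTorsion G p)) :
    Matrix (Fin n) (Fin n) (LaurentSeries (ZMod p)) :=
  Matrix.of fun i l => ∑ t : Fin (2 * r + 1),
    HahnSeries.single ((r : ℤ) - (t : ℕ)) (LinearMap.toMatrix b b (torsionPart hf p t) i l)

/-- Multiplication by `X ^ (r - t)` brings the coefficient at `a + t - r`, the neighbour with index
`t`, to position `a`. -/
lemma seriesConfig_mulVec (hf : IsAdditive r f)
    (b : Module.Basis (Fin n) (ZMod p) (pTorsion G p)) (y : Fin n → LaurentSeries (ZMod p)) :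
    seriesConfig b ((seriesMatrix hf b).mulVec y) = globalRule r f (seriesConfig b y) := by
  funext a
  have key : (fun i => ((seriesMatrix hf b).mulVec y i).coeff a) =
      ∑ t : Fin (2 * r + 1), b.equivFun (torsionPart hf p t
        (b.equivFun.symm fun i => (y i).coeff (a + (t : ℕ) - r))) := by
    funext i
    rw [Finset.sum_apply]
    simp only [Matrix.mulVec, dotProduct, seriesMatrix, Matrix.of_apply, HahnSeries.coeff_sum,
      Finset.sum_mul, HahnSeries.coeff_single_mul]
    rw [Finset.sum_comm]
    refine Finset.sum_congr rfl fun t _ => ?_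
    rw [Module.Basis.equivFun_apply, ← LinearMap.toMatrix_mulVec_repr b b]
    simp only [Matrix.mulVec, dotProduct, ← Module.Basis.equivFun_apply,
      LinearEquiv.apply_symm_apply]
    refine Finset.sum_congr rfl fun l _ => ?_
    congr 2
    ring
  rw [seriesConfig, key, map_sum, AddSubgroup.val_finsetSum, globalRule, localRule_eq_sum hf]
  refine Finset.sum_congr rfl fun t _ => ?_
  rw [LinearEquiv.symm_apply_apply, coe_torsionPart]
  rfl

lemma seriesConfig_pow_mulVec (hf : IsAdditive r f)
    (b : Module.Basis (Fin n) (ZMod p) (pTorsion G p)) (y : Fin n → LaurentSeries (ZMod p))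
    (i : ℕ) :
    seriesConfig b ((seriesMatrix hf b ^ i).mulVec y) =
      (globalRule r f)^[i] (seriesConfig b y) := by
  induction i with
  | zero => simp
  | succ i ih =>
    rw [pow_succ', ← Matrix.mulVec_mulVec, seriesConfig_mulVec, ih, Function.iterate_succ_apply']

lemma expands_iff_shrinks (hf : IsAdditive r f)
    (b : Module.Basis (Fin n) (ZMod p) (pTorsion G p)) (N : ℕ) :
    Expands (seriesMatrix hf b) N ↔ Shrinks (globalRule r f) p N := by
  constructor
  · intro h c hc hN
    obtain ⟨y, rfl⟩ := exists_seriesConfig_eq b hc (hN 0 (Nat.zero_le N))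
    refine (ordGE_iff_seriesConfig b y 1).1 (h y fun i hi => ?_) 0 (by norm_num)
    rw [ordGE_iff_seriesConfig b, seriesConfig_pow_mulVec]
    exact hN i hi
  · intro h y hy
    have hN : ∀ i ≤ N, ∀ j < 0, (globalRule r f)^[i] (seriesConfig b y) j = 0 := by
      intro i hi
      rw [← seriesConfig_pow_mulVec hf, ← ordGE_iff_seriesConfig]
      exact hy i hi
    rw [ordGE_iff_seriesConfig b]
    intro j hj
    rcases lt_or_ge j 0 with h0 | h0
    · exact hN 0 (Nat.zero_le N) j h0
    · obtain rfl : j = 0 := by omega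
      exact h _ (nsmul_seriesConfig b y) hN

lemma Shrinks.mono {F : (ℤ → G) → (ℤ → G)} {p N N' : ℕ} (hN : N ≤ N') (h : Shrinks F p N) :
    Shrinks F p N' :=
  fun c hc hc' => h c hc fun i hi => hc' i (hi.trans hN)

/-- The dimension `n` of the torsion satisfies `n < p ^ n ≤ |G|`, which gives a number of steps that
can be read off the input. -/
lemma Shrinks.card [Finite G] (hf : IsAdditive r f) {L : ℕ}
    (h : Shrinks (globalRule r f) p L) : Shrinks (globalRule r f) p (Nat.card G) := by
  have : Module.Finite (ZMod p) (pTorsion G p) := Module.Finite.of_finite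
  let b := Module.finBasis (ZMod p) (pTorsion G p)
  have h1 := ((expands_iff_shrinks hf b L).2 h).finrank
  refine ((expands_iff_shrinks hf b _).1 h1).mono ?_
  have h2 : Nat.card (pTorsion G p) = p ^ Module.finrank (ZMod p) (pTorsion G p) := by
    rw [Module.natCard_eq_pow_finrank (K := ZMod p), Nat.card_zmod]
  have h3 : Nat.card (pTorsion G p) ≤ Nat.card G :=
    Nat.card_le_card_of_injective _ Subtype.val_injective
  exact (Nat.lt_pow_self (Fact.out : p.Prime).one_lt).le.trans (h2 ▸ h3)

end TorsionSeries

lemma positivelyExpansive_iff_shrinks {G : Type*} [AddCommGroup G] [Finite G] {r : ℕ}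
    {f : (Fin (2 * r + 1) → G) → G} (hf : IsAdditive r f) :
    PositivelyExpansive (globalRule r f) ↔ ∀ p : ℕ, p.Prime →
      Shrinks (globalRule r f) p (Nat.card G) ∧
        Shrinks (globalRule r (revRule f)) p (Nat.card G) := by
  rw [← coe_caHom hf, positivelyExpansive_iff_separates, coe_caHom, separates_iff_halfLine hf]
  constructor
  · rintro ⟨h, h'⟩ p hp
    have : Fact p.Prime := ⟨hp⟩
    obtain ⟨L, hL⟩ := h.exists_shrinks p
    obtain ⟨L', hL'⟩ := h'.exists_shrinks p
    exact ⟨hL.card hf, hL'.card hf.revRule⟩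
  · intro h
    exact ⟨.of_shrinks hf fun p hp => ⟨_, (h p hp).1⟩,
      .of_shrinks hf.revRule fun p hp => ⟨_, (h p hp).2⟩⟩

/-! ### Finite space-time diagrams as counterexamples. -/

section Diagrams

variable {G : Type*} [AddCommGroup G] {r : ℕ} {f : (Fin (2 * r + 1) → G) → G} {p N : ℕ}

/-- A finite space-time diagram of a `p`-torsion configuration that vanishes left of the cell
`2 * r` during `N` steps, but not at this cell. -/
def IsDiagram (f : (Fin (2 * r + 1) → G) → G) (p N : ℕ) (X : ℕ → ℕ → G) : Prop :=
  (∀ i < N, ∀ j < r * N + 1, X (i + 1) (j + r) = f fun t => X i (j + t)) ∧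
    (∀ j < 2 * r + r * N + 1, p • X 0 j = 0) ∧
    (∀ i < N + 1, ∀ j < 2 * r, X i j = 0) ∧ X 0 (2 * r) ≠ 0

lemma IsDiagram.congr {X Y : ℕ → ℕ → G} (h : IsDiagram f p N X)
    (hXY : ∀ i < N + 1, ∀ j < 2 * r + r * N + 1, X i j = Y i j) : IsDiagram f p N Y := by
  obtain ⟨h1, h2, h3, h4⟩ := h
  refine ⟨fun i hi j hj => ?_, fun j hj => ?_, fun i hi j hj => ?_, ?_⟩
  · rw [← hXY _ (by omega) _ (by omega), h1 i hi j hj]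
    congr 1
    funext t
    exact hXY _ (by omega) _ (by omega)
  · rw [← hXY _ (by omega) _ hj, h2 j hj]
  · rw [← hXY _ hi _ (by omega), h3 i hi j hj]
  · rwa [← hXY _ (by omega) _ (by omega)]

/-- Column `j` of the diagram is cell `j - 2 * r` of the counterexample. -/
lemma exists_isDiagram_of_not_shrinks
    (h : ¬ Shrinks (globalRule r f) p N) : ∃ X, IsDiagram f p N X := by
  unfold Shrinks at h
  push Not at h
  obtain ⟨c, hpc, hc, h0⟩ := h
  refine ⟨fun i j => (globalRule r f)^[i] c (j - 2 * r), fun i _ j _ => ?_, fun j _ => ?_,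
    fun i hi j hj => hc i (by omega) _ (by omega), by simpa using h0⟩
  · beta_reduce
    rw [Function.iterate_succ_apply', globalRule]
    refine congrArg f (funext fun t => congrArg ((globalRule r f)^[i] c) ?_)
    push_cast
    ring
  · exact congrFun hpc _

/-- Row `0`, padded with zeros, is a counterexample after a shift. The unknown right end spoils `r`
columns per step, and the width leaves columns up to `2 * r` exact after `N` steps. On the left, a
cell before `r` reads only cells before `2 * r`, so the strip of zeros protects itself. -/
lemma IsDiagram.not_shrinks (hf : IsAdditive r f) {X : ℕ → ℕ → G} (h : IsDiagram f p N X) :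
    ¬ Shrinks (globalRule r f) p N := by
  obtain ⟨h1, h2, h3, h4⟩ := h
  let c : ℤ → G := fun j => if 0 ≤ j ∧ j < 2 * r + r * N + 1 then X 0 j.toNat else 0
  have hcX : ∀ j : ℕ, j < 2 * r + r * N + 1 → c j = X 0 j := fun j hj => by
    have : (0 : ℤ) ≤ j ∧ (j : ℤ) < 2 * r + r * N + 1 := ⟨by positivity, by exact_mod_cast hj⟩
    simp only [c, if_pos this, Int.toNat_natCast]
  have key : ∀ i ≤ N, (∀ j : ℤ, j < 2 * r → (globalRule r f)^[i] c j = 0) ∧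
      ∀ j : ℕ, j + r * i < 2 * r + r * N + 1 → (globalRule r f)^[i] c j = X i j := by
    intro i
    induction i with
    | zero =>
      intro _
      refine ⟨fun j hj => ?_, fun j hj => hcX j (by simpa using hj)⟩
      rcases lt_or_ge j 0 with h0 | h0
      · exact if_neg (by omega)
      · obtain ⟨j, rfl⟩ := Int.eq_ofNat_of_zero_le h0
        exact (hcX j (by omega)).trans (h3 0 (by omega) j (by omega))
    | succ i ih =>
      intro hi
      obtain ⟨ih1, ih2⟩ := ih (by omega)
      have hri : r * i + r ≤ r * N := by
        rw [← Nat.mul_succ]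
        exact Nat.mul_le_mul_left r hi
      have hleft : ∀ j : ℤ, j < r → (globalRule r f)^[i + 1] c j = 0 := by
        intro j hj
        rw [Function.iterate_succ_apply', globalRule]
        refine Eq.trans (congrArg f ?_) (localRule_zero hf)
        funext t
        exact ih1 _ (by omega)
      have hX : ∀ j : ℕ, j + r * (i + 1) < 2 * r + r * N + 1 →
          (globalRule r f)^[i + 1] c j = X (i + 1) j := by
        intro j hj
        rw [Nat.mul_succ] at hj
        rcases lt_or_ge j r with hjr | hjr
        · rw [hleft j (by exact_mod_cast hjr), h3 (i + 1) (by omega) j (by omega)]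
        · obtain ⟨d, rfl⟩ := Nat.exists_eq_add_of_le' hjr
          rw [h1 i (by omega) d (by omega), Function.iterate_succ_apply', globalRule]
          refine congrArg f (funext fun t => ?_)
          rw [← ih2 _ (by omega)]
          refine congrArg ((globalRule r f)^[i] c) ?_
          push_cast
          ring
      refine ⟨fun j hj => ?_, hX⟩
      rcases lt_or_ge j 0 with h0 | h0
      · exact hleft j (by omega)
      · obtain ⟨j, rfl⟩ := Int.eq_ofNat_of_zero_le h0
        rw [hX j (by rw [Nat.mul_succ]; omega)]
        exact h3 _ (by omega) j (by omega)
  intro hs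
  refine h4 ?_
  rw [← hcX _ (by omega)]
  have := hs (fun j => c (j + (2 * r : ℕ))) ?_ fun i hi j hj => ?_
  · simpa using this
  · funext j
    change p • (if _ then _ else _) = (0 : G)
    split_ifs with hj
    · exact h2 _ (by omega)
    · exact smul_zero p
  · rw [globalRule_iterate_shift]
    exact (key i hi).1 _ (by push_cast; omega)

end Diagrams

/-! ### Certificates are recognised by a primitive recursive bounded search. -/

section Tables

/-- The entry of the addition table at the given row and column. -/
def tableAdd (tab : List (List ℕ)) (a b : ℕ) : ℕ := (tab.getD a []).getD b 0

/-- The number `Z` in base `q` is a space-time diagram showing that the automaton with the given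
tables is not positively expansive. The rows consist of `2 * r + r * q + 1` digits. -/
def IsCertificate (x : Code) (p z Z : ℕ) : Prop :=
  (∀ i < x.1, ∀ j < x.2.2.1 * x.1 + 1,
    Z / x.1 ^ ((2 * x.2.2.1 + x.2.2.1 * x.1 + 1) * (i + 1) + (j + x.2.2.1)) % x.1 =
      x.2.2.2.getD (Z / x.1 ^ ((2 * x.2.2.1 + x.2.2.1 * x.1 + 1) * i + j) %
        x.1 ^ (2 * x.2.2.1 + 1)) 0) ∧
  (∀ j < 2 * x.2.2.1 + x.2.2.1 * x.1 + 1, (tableAdd x.2.1 (Z / x.1 ^ j % x.1))^[p] z = z) ∧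
  (((∀ i < x.1 + 1, ∀ j < 2 * x.2.2.1,
      Z / x.1 ^ ((2 * x.2.2.1 + x.2.2.1 * x.1 + 1) * i + j) % x.1 = z) ∧
      Z / x.1 ^ (2 * x.2.2.1) % x.1 ≠ z) ∨
    ((∀ i < x.1 + 1, ∀ j < 2 * x.2.2.1,
      Z / x.1 ^ ((2 * x.2.2.1 + x.2.2.1 * x.1 + 1) * i + (2 * x.2.2.1 + x.2.2.1 * x.1 - j)) %
        x.1 = z) ∧
      Z / x.1 ^ (x.2.2.1 * x.1) % x.1 ≠ z))

/-- There is a certificate against positive expansivity. -/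
def HasCertificate (x : Code) : Prop :=
  ∃ p < x.1 + 1, (2 ≤ p ∧ ∀ a < p, ∀ b < p, a * b ≠ p) ∧
    ∃ z < x.1, tableAdd x.2.1 z z = z ∧
      ∃ Z < x.1 ^ ((2 * x.2.2.1 + x.2.2.1 * x.1 + 1) * (x.1 + 1)), IsCertificate x p z Z

variable {α : Type*} [Primcodable α]

lemma primrecPred_exists_lt {b : α → ℕ} {P : α → ℕ → Prop} (hb : Primrec b)
    (hP : PrimrecPred fun x : α × ℕ => P x.1 x.2) : PrimrecPred fun a => ∃ n < b a, P a n := by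
  have h : PrimrecRel fun (n : ℕ) (a : α) => P a n :=
    PrimrecPred.comp (f := fun y : ℕ × α => (y.2, y.1)) hP (Primrec.pair Primrec.snd Primrec.fst)
  exact (h.exists_mem_list.comp (Primrec.list_range.comp hb) Primrec.id).of_eq (by simp)

lemma primrecPred_forall_lt {b : α → ℕ} {P : α → ℕ → Prop} (hb : Primrec b)
    (hP : PrimrecPred fun x : α × ℕ => P x.1 x.2) : PrimrecPred fun a => ∀ n < b a, P a n := by
  have h : PrimrecRel fun (n : ℕ) (a : α) => P a n :=
    PrimrecPred.comp (f := fun y : ℕ × α => (y.2, y.1)) hP (Primrec.pair Primrec.snd Primrec.fst)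
  exact (h.forall_mem_list.comp (Primrec.list_range.comp hb) Primrec.id).of_eq (by simp)

lemma primrec_add {g h : α → ℕ} (hg : Primrec g) (hh : Primrec h) :
    Primrec fun a => g a + h a := Primrec.nat_add.comp hg hh

lemma primrec_sub {g h : α → ℕ} (hg : Primrec g) (hh : Primrec h) :
    Primrec fun a => g a - h a := Primrec.nat_sub.comp hg hh

lemma primrec_mul {g h : α → ℕ} (hg : Primrec g) (hh : Primrec h) :
    Primrec fun a => g a * h a := Primrec.nat_mul.comp hg hh

lemma primrec_pow {g h : α → ℕ} (hg : Primrec g) (hh : Primrec h) :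
    Primrec fun a => g a ^ h a := (Primrec₂.unpaired'.1 Nat.Primrec.pow).comp hg hh

lemma primrec_digit {Z q l m : α → ℕ} (hZ : Primrec Z) (hq : Primrec q) (hl : Primrec l)
    (hm : Primrec m) : Primrec fun a => Z a / q a ^ l a % m a :=
  Primrec.nat_mod.comp (Primrec.nat_div.comp hZ (primrec_pow hq hl)) hm

lemma primrecPred_eq {g h : α → ℕ} (hg : Primrec g) (hh : Primrec h) :
    PrimrecPred fun a => g a = h a := Primrec.eq.comp hg hh

lemma primrec_tableAdd {t : α → List (List ℕ)} {g h : α → ℕ} (ht : Primrec t) (hg : Primrec g)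
    (hh : Primrec h) : Primrec fun a => tableAdd (t a) (g a) (h a) :=
  (Primrec.list_getD 0).comp ((Primrec.list_getD []).comp ht hg) hh

lemma primrecPred_isCertificate {x : α → Code} {p z Z : α → ℕ} (hx : Primrec x)
    (hp : Primrec p) (hz : Primrec z) (hZ : Primrec Z) :
    PrimrecPred fun a => IsCertificate (x a) (p a) (z a) (Z a) := by
  have hq : Primrec fun a => (x a).1 := Primrec.fst.comp hx
  have ht : Primrec fun a => (x a).2.1 := Primrec.fst.comp (Primrec.snd.comp hx)
  have hr : Primrec fun a => (x a).2.2.1 :=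
    Primrec.fst.comp (Primrec.snd.comp (Primrec.snd.comp hx))
  have hft : Primrec fun a => (x a).2.2.2 :=
    Primrec.snd.comp (Primrec.snd.comp (Primrec.snd.comp hx))
  have h2r := primrec_mul (Primrec.const 2) hr
  have hrq := primrec_mul hr hq
  have hW := Primrec.succ.comp (primrec_add h2r hrq)
  have hfst : Primrec fun a : (α × ℕ) × ℕ => a.1.1 := Primrec.fst.comp Primrec.fst
  have hi : Primrec fun a : (α × ℕ) × ℕ => a.1.2 := Primrec.snd.comp Primrec.fst
  have hj : Primrec fun a : (α × ℕ) × ℕ => a.2 := Primrec.snd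
  have hfst' : Primrec fun a : α × ℕ => a.1 := Primrec.fst
  refine .and ?_ (.and ?_ (.or (.and ?_ ?_) (.and ?_ ?_)))
  · refine primrecPred_forall_lt hq (primrecPred_forall_lt
      ((Primrec.succ.comp hrq).comp hfst') (primrecPred_eq ?_ ?_))
    · exact primrec_digit (hZ.comp hfst) (hq.comp hfst)
        (primrec_add (primrec_mul (hW.comp hfst) (Primrec.succ.comp hi))
          (primrec_add hj (hr.comp hfst))) (hq.comp hfst)
    · exact (Primrec.list_getD 0).comp (hft.comp hfst) <|
        primrec_digit (hZ.comp hfst) (hq.comp hfst)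
          (primrec_add (primrec_mul (hW.comp hfst) hi) hj)
          (primrec_pow (hq.comp hfst) ((Primrec.succ.comp h2r).comp hfst))
  · refine primrecPred_forall_lt hW (primrecPred_eq ?_ (hz.comp hfst'))
    refine Primrec.nat_iterate (hp.comp hfst') (hz.comp hfst') ?_
    exact primrec_tableAdd ((ht.comp hfst').comp Primrec.fst)
      ((primrec_digit (hZ.comp hfst') (hq.comp hfst') Primrec.snd (hq.comp hfst')).comp
        Primrec.fst) Primrec.snd
  · exact primrecPred_forall_lt (Primrec.succ.comp hq) (primrecPred_forall_lt
      (h2r.comp hfst') (primrecPred_eq (primrec_digit (hZ.comp hfst) (hq.comp hfst)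
        (primrec_add (primrec_mul (hW.comp hfst) hi) hj) (hq.comp hfst)) (hz.comp hfst)))
  · exact (primrecPred_eq (primrec_digit hZ hq h2r hq) hz).not
  · exact primrecPred_forall_lt (Primrec.succ.comp hq) (primrecPred_forall_lt
      (h2r.comp hfst') (primrecPred_eq (primrec_digit (hZ.comp hfst) (hq.comp hfst)
        (primrec_add (primrec_mul (hW.comp hfst) hi)
          (primrec_sub ((primrec_add h2r hrq).comp hfst) hj)) (hq.comp hfst)) (hz.comp hfst)))
  · exact (primrecPred_eq (primrec_digit hZ hq hrq hq) hz).not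

lemma primrecPred_hasCertificate : PrimrecPred HasCertificate := by
  have hq : Primrec fun x : Code => x.1 := Primrec.fst
  have ht : Primrec fun x : Code => x.2.1 := Primrec.fst.comp Primrec.snd
  have hr : Primrec fun x : Code => x.2.2.1 := Primrec.fst.comp (Primrec.snd.comp Primrec.snd)
  have hW := Primrec.succ.comp (primrec_add (primrec_mul (Primrec.const 2) hr) (primrec_mul hr hq))
  have hB := primrec_pow hq (primrec_mul hW (Primrec.succ.comp hq))
  have h1 : Primrec fun a : Code × ℕ => a.1 := Primrec.fst
  have h2 : Primrec fun a : (Code × ℕ) × ℕ => a.1.1 := Primrec.fst.comp Primrec.fst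
  have h3 : Primrec fun a : ((Code × ℕ) × ℕ) × ℕ => a.1.1.1 := h2.comp Primrec.fst
  refine primrecPred_exists_lt (Primrec.succ.comp hq) (.and (.and ?_ ?_) ?_)
  · exact Primrec.nat_le.comp (Primrec.const 2) Primrec.snd
  · exact primrecPred_forall_lt Primrec.snd (primrecPred_forall_lt
      (Primrec.snd.comp Primrec.fst) (primrecPred_eq (primrec_mul
        (Primrec.snd.comp Primrec.fst) Primrec.snd)
        (Primrec.snd.comp (Primrec.fst.comp Primrec.fst))).not)
  · refine primrecPred_exists_lt (hq.comp h1) (.and (primrecPred_eq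
      (primrec_tableAdd (ht.comp h2) Primrec.snd Primrec.snd) Primrec.snd) ?_)
    exact primrecPred_exists_lt (hB.comp h2) (primrecPred_isCertificate h3
      (Primrec.snd.comp (Primrec.fst.comp Primrec.fst)) (Primrec.snd.comp Primrec.fst) Primrec.snd)

end Tables

/-! ### Certificates for an encoded automaton are diagrams. -/

section Encoding

lemma getD_ofFn {α : Type*} {n : ℕ} (g : Fin n → α) (d : α) (i : Fin n) :
    (List.ofFn g).getD i d = g i := by
  rw [List.getD_eq_getElem _ _ (by simp)]
  simp

lemma div_pow_mod_pow_div_pow_mod (Z q l : ℕ) {t m : ℕ} (h : t < m) :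
    Z / q ^ l % q ^ m / q ^ t % q = Z / q ^ (l + t) % q := by
  obtain ⟨d, rfl⟩ := Nat.exists_eq_add_of_lt h
  rw [show q ^ (t + d + 1) = q ^ t * q ^ (d + 1) by rw [← pow_add, add_assoc],
    Nat.mod_mul_right_div_self, Nat.mod_mod_of_dvd _ (dvd_pow_self q d.succ_ne_zero),
    Nat.div_div_eq_div_mul, ← pow_add]

lemma forall_lt_succ_sub (n : ℕ) (P : ℕ → Prop) :
    (∀ j < n + 1, P (n - j)) ↔ ∀ j < n + 1, P j := by
  refine ⟨fun h j hj => ?_, fun h j _ => h _ (by omega)⟩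
  have := h (n - j) (by omega)
  rwa [Nat.sub_sub_self (by omega)] at this

variable {G : Type*} {q : ℕ} (e : G ≃ Fin q) (hq : 0 < q)

/-- The element of the group given by a digit of the number `Z` in base `q`. -/
def digitElem (Z l : ℕ) : G := e.symm ⟨Z / q ^ l % q, Nat.mod_lt _ hq⟩

lemma digit_eq_iff (Z l : ℕ) (g : G) : Z / q ^ l % q = e g ↔ digitElem e hq Z l = g := by
  rw [digitElem, Equiv.symm_apply_eq, Fin.ext_iff]

lemma coe_digitElem (Z l : ℕ) : (e (digitElem e hq Z l) : ℕ) = Z / q ^ l % q := by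
  rw [digitElem, Equiv.apply_symm_apply]

lemma exists_digitElem_eq (D : ℕ → G) (M : ℕ) :
    ∃ Z < q ^ M, ∀ l < M, digitElem e hq Z l = D l := by
  let w : Fin M → Fin q := fun l => e (D l)
  refine ⟨finFunctionFinEquiv w, (finFunctionFinEquiv w).2, fun l hl => ?_⟩
  rw [← digit_eq_iff]
  have := congrFun (finFunctionFinEquiv.symm_apply_apply w) ⟨l, hl⟩
  exact congrArg Fin.val this

variable [AddCommGroup G] {r : ℕ} (f : (Fin (2 * r + 1) → G) → G)

lemma tableAdd_encodeCA (a b : G) :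
    tableAdd (encodeCA e r f).2.1 (e a) (e b) = e (a + b) := by
  simp only [tableAdd, encodeCA, getD_ofFn, Equiv.symm_apply_apply]

lemma tableAdd_iterate_encodeCA (a : G) (p : ℕ) :
    (tableAdd (encodeCA e r f).2.1 (e a))^[p] (e 0) = e (p • a) := by
  induction p with
  | zero => simp
  | succ p ih => rw [Function.iterate_succ_apply', ih, tableAdd_encodeCA, succ_nsmul']

/-- A block of `2 * r + 1` consecutive base `q` digits, taken as a number, is the index of the
corresponding word in the rule table. -/
lemma table_encodeCA (Z l : ℕ) :
    (encodeCA e r f).2.2.2.getD (Z / q ^ l % q ^ (2 * r + 1)) 0 =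
      e (f fun t => digitElem e hq Z (l + t)) := by
  have := getD_ofFn (fun w : Fin (q ^ (2 * r + 1)) =>
    ((e (f fun t => e.symm (finFunctionFinEquiv.symm w t)) : Fin q) : ℕ)) 0
    ⟨Z / q ^ l % q ^ (2 * r + 1), Nat.mod_lt _ (pow_pos hq _)⟩
  refine this.trans ?_
  refine congrArg (fun w => (e (f w) : ℕ)) (funext fun t => congrArg e.symm (Fin.ext ?_))
  exact div_pow_mod_pow_div_pow_mod Z q l t.2

/-- A diagram of the reversed rule is one of `f` with its rows read from right to left. The
evolution and torsion conditions are therefore shared, and only the strip of zeros and the nonzero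
cell change sides. -/
lemma isCertificate_encodeCA (p Z : ℕ) :
    IsCertificate (encodeCA e r f) p (e 0) Z ↔
      IsDiagram f p q (fun i j => digitElem e hq Z ((2 * r + r * q + 1) * i + j)) ∨
        IsDiagram (revRule f) p q (fun i j =>
          digitElem e hq Z ((2 * r + r * q + 1) * i + (2 * r + r * q - j))) := by
  have hT : ∀ j, (tableAdd (encodeCA e r f).2.1 (Z / q ^ j % q))^[p] (e 0) = e 0 ↔
      p • digitElem e hq Z j = 0 := by
    intro j
    rw [← coe_digitElem e hq, tableAdd_iterate_encodeCA, ← Fin.ext_iff, e.injective.eq_iff]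
  have hR : ∀ l m, Z / q ^ l % q =
      (encodeCA e r f).2.2.2.getD (Z / q ^ m % q ^ (2 * r + 1)) 0 ↔
        digitElem e hq Z l = f fun t => digitElem e hq Z (m + t) := by
    intro l m
    rw [table_encodeCA e hq f, digit_eq_iff]
  unfold IsCertificate
  simp only [show (encodeCA e r f).1 = q from rfl, show (encodeCA e r f).2.2.1 = r from rfl,
    hT, hR, Ne, digit_eq_iff e hq]
  rw [← and_assoc, and_or_left]
  set D := digitElem e hq Z
  refine or_congr ?_ ?_
  · simp only [IsDiagram, and_assoc, mul_zero, zero_add, add_assoc]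
  · have h1 : ∀ i, (∀ j < r * q + 1,
        D ((2 * r + r * q + 1) * (i + 1) + (2 * r + r * q - (j + r))) = revRule f fun t =>
          D ((2 * r + r * q + 1) * i + (2 * r + r * q - (j + t)))) ↔
        ∀ j < r * q + 1, D ((2 * r + r * q + 1) * (i + 1) + (j + r)) =
          f fun t => D ((2 * r + r * q + 1) * i + j + t) := by
      intro i
      rw [← forall_lt_succ_sub]
      refine forall₂_congr fun j hj => ?_
      rw [show 2 * r + r * q - (r * q - j + r) = j + r by omega]
      refine Eq.congr_right (congrArg f (funext fun t => congrArg D ?_))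
      rw [Fin.val_rev]
      omega
    have h2 := forall_lt_succ_sub (2 * r + r * q) fun j => p • D j = 0
    simp only [IsDiagram, h1, mul_zero, zero_add, h2, Nat.add_sub_cancel_left, and_assoc]

lemma exists_certificate_iff (hq : 0 < q) (p : ℕ) :
    (∃ Z < q ^ ((2 * r + r * q + 1) * (q + 1)), IsCertificate (encodeCA e r f) p (e 0) Z) ↔
      (∃ X, IsDiagram f p q X) ∨ ∃ X, IsDiagram (revRule f) p q X := by
  have hdiv : ∀ {W i j : ℕ}, j < W → (W * i + j) / W = i ∧ (W * i + j) % W = j := by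
    intro W i j hj
    rw [Nat.mul_add_div (by omega), Nat.div_eq_of_lt hj, Nat.mul_add_mod, Nat.mod_eq_of_lt hj]
    exact ⟨add_zero i, rfl⟩
  have hlt : ∀ {W i j : ℕ}, i < q + 1 → j < W → W * i + j < W * (q + 1) := by
    intro W i j hi hj
    calc W * i + j < W * (i + 1) := by rw [Nat.mul_succ]; omega
      _ ≤ _ := Nat.mul_le_mul_left W hi
  simp only [isCertificate_encodeCA e hq f]
  constructor
  · rintro ⟨Z, -, h | h⟩
    · exact Or.inl ⟨_, h⟩
    · exact Or.inr ⟨_, h⟩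
  · set W := 2 * r + r * q + 1 with hW
    rintro (⟨X, hX⟩ | ⟨X, hX⟩)
    · obtain ⟨Z, hZ, h⟩ := exists_digitElem_eq e hq (fun l => X (l / W) (l % W)) (W * (q + 1))
      refine ⟨Z, hZ, Or.inl (hX.congr fun i hi j hj => ?_)⟩
      rw [h _ (hlt hi hj), (hdiv hj).1, (hdiv hj).2]
    · obtain ⟨Z, hZ, h⟩ := exists_digitElem_eq e hq (fun l => X (l / W) (2 * r + r * q - l % W))
        (W * (q + 1))
      refine ⟨Z, hZ, Or.inr (hX.congr fun i hi j hj => ?_)⟩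
      have hj' : 2 * r + r * q - j < W := by omega
      rw [h _ (hlt hi hj'), (hdiv hj').1, (hdiv hj').2, Nat.sub_sub_self (by omega)]

lemma prime_iff_forall_mul_ne (p : ℕ) :
    (2 ≤ p ∧ ∀ a < p, ∀ b < p, a * b ≠ p) ↔ p.Prime := by
  rw [Nat.prime_iff_not_exists_mul_eq]
  refine and_congr_right fun _ => ⟨?_, ?_⟩
  · rintro h ⟨a, b, ha, hb, hab⟩
    exact h a ha b hb hab
  · exact fun h a ha b hb hab => h ⟨a, b, ha, hb, hab⟩

/-- The nonzero cell of row `0` has order `p`; this bounds the search over primes. -/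
lemma IsDiagram.prime_le_card [Finite G] {f : (Fin (2 * r + 1) → G) → G} {p N : ℕ}
    (hp : p.Prime) {X : ℕ → ℕ → G} (h : IsDiagram f p N X) : p ≤ Nat.card G := by
  have : Fact p.Prime := ⟨hp⟩
  rw [← addOrderOf_eq_prime (h.2.1 (2 * r) (by omega)) h.2.2.2]
  exact Nat.le_of_dvd Nat.card_pos (addOrderOf_dvd_natCard _)

lemma hasCertificate_encodeCA_iff (hf : IsAdditive r f) :
    HasCertificate (encodeCA e r f) ↔ ¬ PositivelyExpansive (globalRule r f) := by
  have hq : 0 < q := (e 0).pos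
  have : Finite G := Finite.of_equiv _ e.symm
  have hcard : Nat.card G = q := by rw [Nat.card_congr e, Nat.card_fin]
  rw [positivelyExpansive_iff_shrinks hf, hcard]
  unfold HasCertificate
  simp only [show (encodeCA e r f).1 = q from rfl, show (encodeCA e r f).2.2.1 = r from rfl,
    prime_iff_forall_mul_ne]
  constructor
  · rintro ⟨p, -, hp, z, hz, hzz, hZ⟩ hall
    obtain ⟨g, hg⟩ := e.surjective ⟨z, hz⟩
    obtain rfl : (e g : ℕ) = z := by rw [hg]
    -- In a group only `0` satisfies `z + z = z`, so the addition table identifies the number of the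
    -- neutral element.
    rw [tableAdd_encodeCA, ← Fin.ext_iff, e.injective.eq_iff, add_eq_left] at hzz
    subst hzz
    rcases (exists_certificate_iff e f hq p).1 hZ with ⟨X, hX⟩ | ⟨X, hX⟩
    · exact hX.not_shrinks hf (hall p hp).1
    · exact hX.not_shrinks hf.revRule (hall p hp).2
  · intro hnot
    push Not at hnot
    obtain ⟨p, hp, h⟩ := hnot
    have hX : (∃ X, IsDiagram f p q X) ∨ ∃ X, IsDiagram (revRule f) p q X := by
      by_cases hs : Shrinks (globalRule r f) p q
      · exact Or.inr (exists_isDiagram_of_not_shrinks (h hs))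
      · exact Or.inl (exists_isDiagram_of_not_shrinks hs)
    have hpq : p ≤ q := by
      rw [← hcard]
      rcases hX with ⟨X, hX⟩ | ⟨X, hX⟩ <;> exact hX.prime_le_card hp
    refine ⟨p, by omega, hp, e 0, (e 0).2, ?_, (exists_certificate_iff e f hq p).2 hX⟩
    rw [tableAdd_encodeCA, add_zero]

end Encoding

theorem exists_computable_decider :
    ∃ D : Code → Bool, Computable D ∧
      ∀ (G : Type*) [AddCommGroup G] (q : ℕ) (e : G ≃ Fin q) (r : ℕ)
        (f : (Fin (2 * r + 1) → G) → G), IsAdditive r f →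
        (D (encodeCA e r f) = true ↔ PositivelyExpansive (globalRule r f)) := by
  classical
  refine ⟨fun x => decide (¬ HasCertificate x), primrecPred_hasCertificate.not.decide.to_comp,
    fun G _ q e r f hf => ?_⟩
  rw [decide_eq_true_iff, hasCertificate_encodeCA_iff e f hf, not_not]

/-! ### Transfer to the associated linear automaton. -/

section Psi

variable {p n : ℕ} [NeZero n] {k : Fin n → ℕ}

lemma isAdditive_linearLocalRule {K : Type*} [CommRing K] {n : ℕ} (r : ℕ)
    (A : Fin (2 * r + 1) → Matrix (Fin n) (Fin n) K) : IsAdditive r (linearLocalRule r A) := by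
  intro c c'
  funext i
  simp only [globalRule, linearLocalRule, Pi.add_apply, Matrix.mulVec_add,
    Finset.sum_add_distrib]

/-- Multiplication by `p ^ (b - a)` from `ℤ/p^a` to `ℤ/p^b`, on representatives. -/
def scaleHom (p : ℕ) {a b : ℕ} (h : a ≤ b) : ZMod (p ^ a) →+ ZMod (p ^ b) :=
  ZMod.lift (p ^ a) ⟨(AddMonoidHom.mulRight ((p ^ (b - a) : ℕ) : ZMod (p ^ b))).comp
    (Int.castAddHom (ZMod (p ^ b))), by
      simp only [AddMonoidHom.comp_apply, Int.coe_castAddHom, AddMonoidHom.coe_mulRight,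
        Int.cast_natCast]
      rw [← Nat.cast_mul, ← pow_add, Nat.add_sub_cancel' h, ZMod.natCast_self]⟩

lemma scaleHom_natCast {a b : ℕ} (h : a ≤ b) (m : ℕ) :
    scaleHom p h (m : ZMod (p ^ a)) = ((m * p ^ (b - a) : ℕ) : ZMod (p ^ b)) := by
  have := ZMod.lift_coe (p ^ a) ⟨(AddMonoidHom.mulRight ((p ^ (b - a) : ℕ) : ZMod (p ^ b))).comp
    (Int.castAddHom (ZMod (p ^ b))), by
      simp only [AddMonoidHom.comp_apply, Int.coe_castAddHom, AddMonoidHom.coe_mulRight,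
        Int.cast_natCast]
      rw [← Nat.cast_mul, ← pow_add, Nat.add_sub_cancel' h, ZMod.natCast_self]⟩ (m : ℤ)
  rw [Int.cast_natCast] at this
  exact this.trans (by simp)

lemma scaleHom_injective (hp : p.Prime) {a b : ℕ} (h : a ≤ b) :
    Function.Injective (scaleHom p h) := by
  have : NeZero (p ^ a) := ⟨pow_ne_zero _ hp.ne_zero⟩
  rw [injective_iff_map_eq_zero]
  intro x hx
  rw [← ZMod.natCast_zmod_val x, scaleHom_natCast, ZMod.natCast_eq_zero_iff] at hx
  rw [← ZMod.natCast_zmod_val x, ZMod.natCast_eq_zero_iff]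
  rw [← Nat.add_sub_cancel' h, pow_add, Nat.add_sub_cancel_left] at hx
  exact Nat.dvd_of_mul_dvd_mul_right (pow_pos hp.pos _) hx

lemma psi_apply (hp : p.Prime) (hk : Antitone k) (h : PGroup p k) (i : Fin n) :
    psi p k h i = scaleHom p (hk (Fin.zero_le i)) (h i) := by
  have : NeZero (p ^ k i) := ⟨pow_ne_zero _ hp.ne_zero⟩
  conv_rhs => rw [← ZMod.natCast_zmod_val (h i), scaleHom_natCast]
  rfl

lemma psi_injective (hp : p.Prime) (hk : Antitone k) : Function.Injective (psi p k) := by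
  intro h h' heq
  funext i
  refine scaleHom_injective hp (hk (Fin.zero_le i)) ?_
  rw [← psi_apply hp hk, ← psi_apply hp hk, heq]

lemma psi_zero (hp : p.Prime) (hk : Antitone k) : psi p k 0 = 0 := by
  funext i
  rw [psi_apply hp hk, Pi.zero_apply, map_zero, Pi.zero_apply]

lemma bigPsi_injective (hp : p.Prime) (hk : Antitone k) : Function.Injective (bigPsi p k) :=
  fun _ _ h => funext fun j => psi_injective hp hk (congrFun h j)

/-- The `p`-torsion of `(ℤ/p^{k_1})^n` lies in the image of `ψ`. -/
lemma exists_psi_eq (hp : p.Prime) (h1 : ∀ i, 1 ≤ k i) (hk : Antitone k)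
    {y : Fin n → ZMod (p ^ k 0)} (hy : p • y = 0) : ∃ h, psi p k h = y := by
  have : NeZero (p ^ k 0) := ⟨pow_ne_zero _ hp.ne_zero⟩
  have key : ∀ i, ∃ x, scaleHom p (hk (Fin.zero_le i)) x = y i := by
    intro i
    have hyi : p • y i = 0 := congrFun hy i
    rw [← ZMod.natCast_zmod_val (y i), nsmul_eq_mul, ← Nat.cast_mul,
      ZMod.natCast_eq_zero_iff] at hyi
    -- A `p`-torsion element is divisible by `p ^ (k 0 - 1)`, which suffices because `k i ≥ 1`.
    have hdvd : p ^ (k 0 - k i) ∣ (y i).val := by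
      refine (pow_dvd_pow p (show k 0 - k i ≤ k 0 - 1 by have := h1 i; omega)).trans ?_
      refine Nat.dvd_of_mul_dvd_mul_left hp.pos ?_
      rwa [← pow_succ', Nat.sub_add_cancel (h1 0)]
    obtain ⟨m, hm⟩ := hdvd
    refine ⟨(m : ZMod (p ^ k i)), ?_⟩
    rw [scaleHom_natCast, mul_comm, ← hm, ZMod.natCast_zmod_val]
  choose x hx using key
  exact ⟨x, funext fun i => by rw [psi_apply hp hk, hx]⟩

variable {r : ℕ} {f : (Fin (2 * r + 1) → PGroup p k) → PGroup p k}

lemma assocMatrix_mul_scaleHom (hp : p.Prime) (hk : Antitone k) (hf : IsAdditive r f)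
    (z : Fin (2 * r + 1)) (i j : Fin n) (x : ZMod (p ^ k j)) :
    assocMatrix p k r f z i j * scaleHom p (hk (Fin.zero_le j)) x =
      scaleHom p (hk (Fin.zero_le i)) (localPart hf z (Pi.single j x) i) := by
  have hj : NeZero (p ^ k j) := ⟨pow_ne_zero _ hp.ne_zero⟩
  have hi : NeZero (p ^ k i) := ⟨pow_ne_zero _ hp.ne_zero⟩
  have hki := hk (Fin.zero_le i)
  have hkj := hk (Fin.zero_le j)
  set w := (f (Pi.single z (Pi.single j 1)) i).val with hw
  have hsingle : localPart hf z (Pi.single j x) i = ((x.val * w : ℕ) : ZMod (p ^ k i)) := by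
    have : (Pi.single j x : PGroup p k) = x.val • Pi.single j 1 := by
      rw [← Pi.single_smul, nsmul_one, ZMod.natCast_zmod_val]
    rw [this, map_nsmul, localPart_apply, Pi.smul_apply, nsmul_eq_mul, Nat.cast_mul, hw,
      ZMod.natCast_zmod_val]
  -- Since `p ^ k j` kills the generator, it kills its image modulo `p ^ k i`; hence the division in
  -- `assocMatrix` is exact.
  have hdvd : p ^ (k i - k j) ∣ w := by
    have h0 : ((p ^ k j * w : ℕ) : ZMod (p ^ k i)) = 0 := by
      rw [Nat.cast_mul, hw, ZMod.natCast_zmod_val, ← nsmul_eq_mul, ← Pi.smul_apply,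
        ← localPart_apply hf, ← map_nsmul, ← Pi.single_smul, nsmul_one, ZMod.natCast_self,
        Pi.single_zero, map_zero, Pi.zero_apply]
    rw [ZMod.natCast_eq_zero_iff] at h0
    rcases le_total (k i) (k j) with h | h
    · rw [Nat.sub_eq_zero_of_le h, pow_zero]
      exact one_dvd _
    · rw [← Nat.add_sub_cancel' h, pow_add] at h0
      exact Nat.dvd_of_mul_dvd_mul_left (pow_pos hp.pos _) h0
  rw [hsingle, scaleHom_natCast]
  conv_lhs => rw [← ZMod.natCast_zmod_val x]
  rw [scaleHom_natCast, assocMatrix, Matrix.of_apply, ← hw, ← Nat.cast_mul]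
  congr 1
  rcases le_total (k i) (k j) with h | h
  · rw [Nat.sub_eq_zero_of_le h, pow_zero, Nat.div_one,
      show k 0 - k i = k j - k i + (k 0 - k j) by omega, pow_add]
    ring
  · obtain ⟨v, hv⟩ := hdvd
    rw [Nat.sub_eq_zero_of_le h, pow_zero, one_mul, hv,
      Nat.mul_div_cancel_left _ (pow_pos hp.pos _),
      show k 0 - k j = k i - k j + (k 0 - k i) by omega, pow_add]
    ring

lemma linearLocalRule_psi (hp : p.Prime) (hk : Antitone k) (hf : IsAdditive r f)
    (w : Fin (2 * r + 1) → PGroup p k) :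
    linearLocalRule r (assocMatrix p k r f) (fun t => psi p k (w t)) = psi p k (f w) := by
  funext i
  rw [psi_apply hp hk, localRule_eq_sum hf, linearLocalRule, Finset.sum_apply, Finset.sum_apply,
    map_sum]
  refine Finset.sum_congr rfl fun t _ => ?_
  conv_rhs => rw [← Finset.univ_sum_single (w t)]
  rw [map_sum, Finset.sum_apply, map_sum, Matrix.mulVec, dotProduct]
  refine Finset.sum_congr rfl fun j _ => ?_
  rw [psi_apply hp hk, assocMatrix_mul_scaleHom hp hk hf]

lemma assocLCA_comp_bigPsi (hp : p.Prime) (hk : Antitone k) (hf : IsAdditive r f) :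
    assocLCA p k r f ∘ bigPsi p k = bigPsi p k ∘ globalRule r f :=
  funext fun c => funext fun i =>
    linearLocalRule_psi hp hk hf fun t => c (i + ((t : ℕ) : ℤ) - (r : ℤ))

/-- If the orbit of a nonzero `c` under `L` is invisible in the window, so is that of a multiple of
order `p`. That multiple is `Ψ` of a configuration whose orbit under `F` is invisible too. The other
direction only uses that `Ψ` is injective and intertwines the maps. -/
lemma positivelyExpansive_assocLCA_iff (hp : p.Prime) (h1 : ∀ i, 1 ≤ k i) (hk : Antitone k)
    (hf : IsAdditive r f) :
    PositivelyExpansive (globalRule r f) ↔ PositivelyExpansive (assocLCA p k r f) := by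
  have hL := isAdditive_linearLocalRule r (assocMatrix p k r f)
  have hiter : ∀ (l : ℕ) (c : ℤ → PGroup p k), (assocLCA p k r f)^[l] (bigPsi p k c) =
      bigPsi p k ((globalRule r f)^[l] c) := fun l c =>
    (Function.Semiconj.iterate_right (f := bigPsi p k) (fun c =>
      (congrFun (assocLCA_comp_bigPsi hp hk hf) c).symm) l c).symm
  have hzero : ∀ (c : ℤ → PGroup p k) (j : ℤ), bigPsi p k c j = 0 ↔ c j = 0 := fun c j => by
    rw [← psi_zero hp hk]
    exact (psi_injective hp hk).eq_iff
  have hzero' : bigPsi p k 0 = 0 := funext fun j => (hzero 0 j).2 rfl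
  rw [← coe_caHom hf, positivelyExpansive_iff_separates, coe_caHom]
  change _ ↔ PositivelyExpansive (caHom hL)
  rw [positivelyExpansive_iff_separates]
  constructor
  · rintro ⟨m, h⟩
    refine ⟨m, fun c hc => by_contra fun hne => ?_⟩
    obtain ⟨p', s, hp', hpc, hsc⟩ := exists_prime_nsmul (N := p ^ k 0)
      (pow_ne_zero _ hp.ne_zero) (c := c) (by
        funext j i
        simp) hne
    -- The order of `s • c` divides both `p'` and `p ^ k 0`; were these coprime, `s • c` would
    -- vanish.
    have hpp : p' = p := by
      by_contra hpne
      have hcop : p'.Coprime (p ^ k 0) :=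
        Nat.Coprime.pow_right _ ((Nat.coprime_primes hp' hp).2 hpne)
      have h2 : p ^ k 0 • s • c = 0 := by
        funext j i
        simp
      have h3 := Nat.dvd_gcd (addOrderOf_dvd_of_nsmul_eq_zero hpc)
        (addOrderOf_dvd_of_nsmul_eq_zero h2)
      rw [hcop, Nat.dvd_one, AddMonoid.addOrderOf_eq_one_iff] at h3
      exact hsc h3
    subst hpp
    choose d hd using fun j => exists_psi_eq hp h1 hk (y := (s • c) j) (congrFun hpc j)
    have hd' : bigPsi p' k d = s • c := funext hd
    refine hsc ?_
    rw [← hd', h d fun l j hj => ?_, hzero']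
    rw [← hzero, ← hiter, hd']
    refine (congrFun (globalRule_iterate_smul hL l s c) j).trans ?_
    rw [Pi.smul_apply]
    exact (congrArg (s • ·) (hc l j hj)).trans (smul_zero s)
  · rintro ⟨m, h⟩
    refine ⟨m, fun c hc => bigPsi_injective hp hk ?_⟩
    rw [hzero']
    refine h _ fun l j hj => ?_
    refine (congrFun (hiter l c) j).trans ((hzero _ _).2 (hc l j hj))

end Psi

end AdditiveCA

theorem mainTheorem6 :
    (∃ D : AdditiveCA.Code → Bool, Computable D ∧
      ∀ (G : Type*) [AddCommGroup G] (q : ℕ) (e : G ≃ Fin q) (r : ℕ)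
        (f : (Fin (2 * r + 1) → G) → G), AdditiveCA.IsAdditive r f →
        (D (AdditiveCA.encodeCA e r f) = true ↔
          AdditiveCA.PositivelyExpansive (AdditiveCA.globalRule r f))) ∧
    (∀ (p : ℕ), p.Prime → ∀ (n : ℕ) [NeZero n] (k : Fin n → ℕ),
      (∀ i, 1 ≤ k i) → Antitone k →
      ∀ (r : ℕ) (f : (Fin (2 * r + 1) → AdditiveCA.PGroup p k) → AdditiveCA.PGroup p k),
        AdditiveCA.IsAdditive r f →
        Function.Injective (AdditiveCA.bigPsi p k) ∧
        AdditiveCA.assocLCA p k r f ∘ AdditiveCA.bigPsi p k =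
          AdditiveCA.bigPsi p k ∘ AdditiveCA.globalRule r f ∧
        (AdditiveCA.PositivelyExpansive (AdditiveCA.globalRule r f) ↔
          AdditiveCA.PositivelyExpansive (AdditiveCA.assocLCA p k r f))) := by
  refine ⟨AdditiveCA.exists_computable_decider, fun p hp n _ k h1 hk r f hf => ?_⟩
  exact ⟨AdditiveCA.bigPsi_injective hp hk, AdditiveCA.assocLCA_comp_bigPsi hp hk hf,
    AdditiveCA.positivelyExpansive_assocLCA_iff hp h1 hk hf⟩
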